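/- **Planar crossed simplicial groups.** These are the following categories, each with objects $[n]$, $n\ge 0$ (for $N,M\ge 1$). - $\Lambda_\infty$ (paracyclic): morphisms $[m]\to[n]$ are the order preserving maps $f:\mathbb Z\to\mathbb Z$ with $f(l+m+1)=f(l)+n+1$ for all $l$. - $\Xi_\infty$ (paradihedral): the maps $f:\mathbb Z\to\mathbb Z$ that either preserve the order and satisfy $f(l+m+1)=f(l)+n+1$, or reverse it and satisfy $f(l+m+1)=f(l)-(n+1)$. - $\Lambda_N$, $\Xi_N$ ($N$-cyclic, $N$-dihedral): the quotients of $\Lambda_\infty$, $\Xi_\infty$ by $f\sim f+rN(n+1)$, $r\in\mathbb Z$. The cyclic and dihedral categories are $\Lambda=\Lambda_1$, $\Xi=\Xi_1$. - $\nabla_M$ ($M$-quaternionic; $\nabla=\nabla_1$ is the quaternionic category): morphisms are pairs $(f,\varepsilon)$ with $f$ a morphism of $\Xi_\infty$ and $\varepsilon\in\mathbb Z/4$, even if $f$ preserves and odd if $f$ reverses the order, modulo $(f,\varepsilon)\sim(f+rM(n+1),\varepsilon+2r)$, $r\in\mathbb Z$; thus $\mathrm{Aut}([n])$ is the quaternion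 group $\langle w,\tau\mid w^2=\tau^{M(n+1)},\ w^4=1,\ w\tau w^{-1}=\tau^{-1}\rangle$. Let $\Delta\mathfrak G$ be one of them, and let $G\to O(2)$ be the corresponding planar Lie group, that is, $SO(2)$, $O(2)$, $\widetilde{SO}(2)$, $\widetilde O(2)=\mathbb Z/2\ltimes\mathbb R$, $\mathrm{Spin}_N(2)$, $\mathrm{Pin}^+_N(2)$, $\mathrm{Pin}^-_{2}(2)$, $\mathrm{Pin}^-_{2M}(2)$ for $\Lambda$, $\Xi$, $\Lambda_\infty$, $\Xi_\infty$, $\Lambda_N$, $\Xi_N$, $\nabla$, $\nabla_M$ respectively. Let $p:\mathrm{Homeo}^G(S^1)\to\mathrm{Homeo}(S^1)$ be the connective covering of the homeomorphism group of $S^1=\mathbb R/\mathbb Z$ that restricts to $G\to O(2)$. Explicitly, $\mathrm{Homeo}^G(S^1)$ consists of the homeomorphisms $f$ of $\mathbb R$ with $f(x+1)=f(x)\pm1$ (only the sign $+$ for $\Lambda,\Lambda_\infty,\Lambda_N$), modulo nothing for $\Lambda_\infty,\Xi_\infty$, modulo translations by $N\mathbb Z$ for $\Lambda_N,\Xi_N$;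 for $\nabla_M$ it consists of pairs $(f,\varepsilon)$, with $\varepsilon\in\mathbb Z/4$ of the parity given by the sign, modulo the subgroup generated by $(x\mapsto x+M,\,2)$. **Structured marked circles.** A $G$-structured marked circle $(C,J)$ is a space $C$ homeomorphic to $S^1$, with a right $\mathrm{Homeo}^G(S^1)$-torsor $F$ and a $p$-equivariant map $\rho:F\to\mathrm{Homeo}(S^1,C)$, and a nonempty closed $J\subset C$ homeomorphic to a finite disjoint union of copies of $[0,1]$. Let $\mathrm{Homeo}^G((C,J),(C',J'))$ be the space of pairs $(\varphi,\widetilde\varphi)$ of a homeomorphism $\varphi:C\to C'$ with $\varphi(J)\subset J'$ and an equivariant homeomorphism $\widetilde\varphi:F\to F'$ with $\rho'\circ\widetilde\varphi=\varphi\circ\rho$, topologized through $\widetilde\varphi\mapsto\widetilde\varphi(f)\in F'\cong\mathrm{Homeo}^G(S^1)$ for $f\in F$. The category $\mathcal C^G$ has the $G$-structured marked circles as objects and $\mathrm{Hom}((C,J),(C',J'))=\pi_0\,\mathrm{Homeo}^G((C,J),(C',J'))$. **Statement.** Every planar crossed simplicial group is self-dual, through interstice duality: 1. For every $G$-structured marked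 circle $(C,J)$, the pair $(C,\overline{C\setminus J})$ is again a $G$-structured marked circle, and $(C,J)^\vee=(C,\overline{C\setminus J})$, $[(\varphi,\widetilde\varphi)]^\vee=[(\varphi^{-1},\widetilde\varphi^{-1})]$ is an equivalence of categories $(-)^\vee:\mathcal C^G\to(\mathcal C^G)^{\mathrm{op}}$. 2. There are an equivalence $E:\mathcal C^G\simeq\Delta\mathfrak G$, sending each $(C,J)$ for which $J$ has $n+1$ components to an object isomorphic to $[n]$, and an equivalence $D:\Delta\mathfrak G\simeq\Delta\mathfrak G^{\mathrm{op}}$ with $D([n])=[n]$ for all $n\ge0$, such that $D$ is induced by interstice duality: $D\circ E\cong E^{\mathrm{op}}\circ(-)^\vee$. -/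

import Mathlib

open CategoryTheory Topology

namespace PlanarDuality

noncomputable section

/-! ### The list of planar types -/

/-- The list of planar crossed simplicial groups, equivalently of planar Lie groups
(connective coverings of `O(2)`):
* `cyclic`: `Λ`, with `SO(2)`;
* `dihedral`: `Ξ`, with `O(2)`;
* `paracyclic`: `Λ_∞`, with the universal covering of `SO(2)`;
* `paradihedral`: `Ξ_∞`, with `ℤ/2 ⋉ ℝ`;
* `nCyclic N`: `Λ_N`, with `Spin_N(2)`;
* `nDihedral N`: `Ξ_N`, with `Pin⁺_N(2)`;
* `quaternionic`: `∇`, with `Pin⁻_2(2)`, the normalizer of a maximal torus in `SU(2)`;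
* `nQuaternionic M`: `∇_M`, with `Pin⁻_{2M}(2)`. -/
inductive PlanarType
  | cyclic
  | dihedral
  | paracyclic
  | paradihedral
  | nCyclic (N : ℕ+)
  | nDihedral (N : ℕ+)
  | quaternionic
  | nQuaternionic (M : ℕ+)

/-- The parameters in which the planar types differ: a group `S` of (refined) orientation
characters with its sign `χ : S → {±1}`, and a relation identifying the translation by `N` full
turns with the element `z` of `S` (`N = 0`, `z = 1` means that nothing is identified). -/
structure PlanarDatum where
  S : Type
  [commGroup : CommGroup S]
  χ : S →* ℤˣ
  N : ℕ
  z : S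
  sign_z : χ z = 1
  sq_z : z * z = 1

attribute [instance] PlanarDatum.commGroup

/-- The parity `ℤ/4 → {±1}`, `k ↦ (-1)^k`. -/
def parityFour : Multiplicative (ZMod 4) →* ℤˣ where
  toFun k := if k.toAdd.val % 2 = 0 then 1 else -1
  map_one' := by decide
  map_mul' := by decide

/-- Only orientation preserving maps; translations by multiples of `N` turns become trivial. -/
def orientedDatum (N : ℕ) : PlanarDatum where
  S := Unit
  χ := 1
  N := N
  z := 1
  sign_z := rfl
  sq_z := rfl

/-- Orientation preserving and reversing maps; translations by multiples of `N` turns become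
trivial. -/
def unorientedDatum (N : ℕ) : PlanarDatum where
  S := ℤˣ
  χ := MonoidHom.id ℤˣ
  N := N
  z := 1
  sign_z := rfl
  sq_z := rfl

/-- Maps together with an element of `ℤ/4` whose parity is the orientation behaviour;
the translation by `M` turns is identified with `2 ∈ ℤ/4`. In particular a reflection `w` (which
carries the element `1 ∈ ℤ/4`) satisfies `w² = ` translation by `M` turns. -/
def quaternionicDatum (M : ℕ) : PlanarDatum where
  S := Multiplicative (ZMod 4)
  χ := parityFour
  N := M
  z := Multiplicative.ofAdd 2
  sign_z := by decide
  sq_z := by decide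

def PlanarType.datum : PlanarType → PlanarDatum
  | .cyclic => orientedDatum 1
  | .dihedral => unorientedDatum 1
  | .paracyclic => orientedDatum 0
  | .paradihedral => unorientedDatum 0
  | .nCyclic N => orientedDatum N
  | .nDihedral N => unorientedDatum N
  | .quaternionic => quaternionicDatum 1
  | .nQuaternionic M => quaternionicDatum M

/-! ### Planar crossed simplicial groups -/

section Combinatorial

variable (D : PlanarDatum)

/-- A map `f : ℤ → ℤ` with `f (l + m + 1) = f l ± (n + 1)`, preserving the order if the sign is
`+` and reversing it if the sign is `-`, with a chosen `s ∈ S` over the sign. For `S = 1` and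
`S = {±1}` the element `s` is no additional datum. -/
@[ext]
structure PeriodicMap (m n : ℕ) where
  toFun : ℤ → ℤ
  s : D.S
  monotone : D.χ s = 1 → Monotone toFun
  antitone : D.χ s = -1 → Antitone toFun
  periodic : ∀ l : ℤ, toFun (l + (m + 1)) = toFun l + (D.χ s : ℤ) * (n + 1)

variable {D}

/-- `f ~ g` if `g = f + r N (n + 1)` for some integer `r`, with the matching change by `z ^ r`
in `S`. -/
def PeriodicMap.setoid (m n : ℕ) : Setoid (PeriodicMap D m n) where
  r f g := ∃ r : ℤ, g.s = f.s * D.z ^ r ∧ ∀ l, g.toFun l = f.toFun l + r * (D.N * (n + 1))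
  iseqv := by
    refine ⟨fun f => ⟨0, by simp, by simp⟩, ?_, ?_⟩
    · rintro f g ⟨r, h1, h2⟩
      exact ⟨-r, by simp [h1], fun l => by rw [h2]; ring⟩
    · rintro f g h ⟨r, h1, h2⟩ ⟨t, h3, h4⟩
      exact ⟨r + t, by rw [h3, h1, mul_assoc, zpow_add], fun l => by rw [h4, h2]; ring⟩

theorem sign_cases (s : D.S) : D.χ s = 1 ∨ D.χ s = -1 := Int.units_eq_one_or _

theorem zpow_z_neg (r : ℤ) : D.z ^ (-r) = D.z ^ r := by
  have h : D.z⁻¹ = D.z := inv_eq_of_mul_eq_one_left D.sq_z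
  rw [zpow_neg, ← inv_zpow, h]

namespace PeriodicMap

def id (n : ℕ) : PeriodicMap D n n where
  toFun l := l
  s := 1
  monotone _ := monotone_id
  antitone h := by rw [map_one] at h; exact absurd h (by decide)
  periodic l := by simp

/-- A periodic map turns translation by `k` periods into translation by `± k` periods. -/
theorem map_add_mul {m n : ℕ} (f : PeriodicMap D m n) (l k : ℤ) :
    f.toFun (l + k * (m + 1)) = f.toFun l + (D.χ f.s : ℤ) * k * (n + 1) := by
  induction k using Int.induction_on with
  | zero => simp
  | succ i ih =>
    have h := f.periodic (l + i * (m + 1))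
    rw [ih] at h
    rw [show l + ((i : ℤ) + 1) * (m + 1) = l + i * (m + 1) + (m + 1) by ring, h]
    ring
  | pred i ih =>
    have h := f.periodic (l + (-(i : ℤ) - 1) * (m + 1))
    rw [show l + (-(i : ℤ) - 1) * (m + 1) + (m + 1) = l + -(i : ℤ) * (m + 1) by ring, ih] at h
    linear_combination -h

/-- First `f`, then `g`. -/
def comp {m n k : ℕ} (f : PeriodicMap D m n) (g : PeriodicMap D n k) : PeriodicMap D m k where
  toFun l := g.toFun (f.toFun l)
  s := g.s * f.s
  monotone h := by
    rw [map_mul] at h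
    rcases sign_cases f.s with hf | hf <;> rcases sign_cases g.s with hg | hg
    · exact (g.monotone hg).comp (f.monotone hf)
    · rw [hf, hg] at h; exact absurd h (by decide)
    · rw [hf, hg] at h; exact absurd h (by decide)
    · exact (g.antitone hg).comp (f.antitone hf)
  antitone h := by
    rw [map_mul] at h
    rcases sign_cases f.s with hf | hf <;> rcases sign_cases g.s with hg | hg
    · rw [hf, hg] at h; exact absurd h (by decide)
    · exact (g.antitone hg).comp_monotone (f.monotone hf)
    · exact (g.monotone hg).comp_antitone (f.antitone hf)
    · rw [hf, hg] at h; exact absurd h (by decide)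
  periodic l := by
    rw [f.periodic, g.map_add_mul, map_mul, Units.val_mul]

theorem comp_rel {m n k : ℕ} {f f' : PeriodicMap D m n} {g g' : PeriodicMap D n k}
    (hf : setoid m n f f') (hg : setoid n k g g') :
    setoid m k (f.comp g) (f'.comp g') := by
  obtain ⟨r, h1, h2⟩ := hf
  obtain ⟨t, h3, h4⟩ := hg
  refine ⟨t + (D.χ g.s : ℤ) * r, ?_, fun l => ?_⟩
  · have : D.z ^ ((D.χ g.s : ℤ) * r) = D.z ^ r := by
      rcases sign_cases g.s with h | h
      · simp [h]
      · simp only [h, Units.val_neg, Units.val_one, neg_mul, one_mul, zpow_z_neg]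
    change g'.s * f'.s = g.s * f.s * _
    rw [h1, h3, zpow_add, this]
    exact mul_mul_mul_comm _ _ _ _ |>.trans (by rw [mul_comm (D.z ^ t)])
  · change g'.toFun (f'.toFun l) = g.toFun (f.toFun l) + _
    rw [h4, h2, ← mul_assoc r, g.map_add_mul]
    ring

end PeriodicMap

/-- The category with objects `[n]`, `n ≥ 0`, whose morphisms `[m] → [n]` are equivalence classes
of periodic maps. The simplex category sits inside it as the classes of the maps `f` with
`f {0, …, m} ⊆ {0, …, n}` and `s = 1`, and every morphism factors uniquely as an automorphism
followed by a morphism of the simplex category. The automorphisms of `[n]` are generated by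
`τ = (l ↦ l + 1, 1)` and, if reflections are allowed, by the reflection `w : l ↦ n - l`. In the
quaternionic case `w` carries the generator of `ℤ/4`, and `w² = τ ^ (M (n + 1))`,
`w τ w⁻¹ = τ⁻¹` present the quaternion group of order `4 M (n + 1)`. -/
@[ext]
structure Obj (D : PlanarDatum) where
  n : ℕ

instance : Category (Obj D) where
  Hom a b := Quotient (PeriodicMap.setoid (D := D) a.n b.n)
  id a := Quotient.mk _ (PeriodicMap.id a.n)
  comp f g := Quotient.map₂ PeriodicMap.comp
    (fun _ _ hf _ _ hg => PeriodicMap.comp_rel hf hg) f g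
  id_comp f := by
    induction f using Quotient.inductionOn
    exact congrArg (Quotient.mk _) (PeriodicMap.ext rfl (mul_one _))
  comp_id f := by
    induction f using Quotient.inductionOn
    exact congrArg (Quotient.mk _) (PeriodicMap.ext rfl (one_mul _))
  assoc f g h := by
    induction f using Quotient.inductionOn
    induction g using Quotient.inductionOn
    induction h using Quotient.inductionOn
    exact congrArg (Quotient.mk _) (PeriodicMap.ext rfl (mul_assoc _ _ _).symm)

end Combinatorial

/-- The planar crossed simplicial group of the given type, as a category. -/
abbrev PlanarCSG (T : PlanarType) : Type := Obj T.datum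

/-- The object `[n]`. -/
abbrev ob (T : PlanarType) (n : ℕ) : PlanarCSG T := ⟨n⟩

/-! ### Planar homeomorphism groups -/

/-- The topology on a group of homeomorphisms: compact-open convergence of `f` and of `f⁻¹`. -/
instance homeoTopology (X : Type*) [TopologicalSpace X] : TopologicalSpace (X ≃ₜ X) :=
  TopologicalSpace.induced
    (fun f => ((⟨f, f.continuous⟩ : C(X, X)), (⟨f.symm, f.symm.continuous⟩ : C(X, X))))
    inferInstance

instance homeoGroup (X : Type*) [TopologicalSpace X] [LocallyCompactSpace X] :
    IsTopologicalGroup (X ≃ₜ X) where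
  continuous_mul := by
    have h : Continuous (fun f : X ≃ₜ X =>
        ((⟨f, f.continuous⟩ : C(X, X)), (⟨f.symm, f.symm.continuous⟩ : C(X, X)))) :=
      continuous_induced_dom
    rw [continuous_induced_rng]
    refine Continuous.prodMk ?_ ?_
    · exact ContinuousMap.continuous_comp'.comp
        (((continuous_fst.comp h).comp continuous_snd).prodMk
          ((continuous_fst.comp h).comp continuous_fst))
    · exact ContinuousMap.continuous_comp'.comp
        (((continuous_snd.comp h).comp continuous_fst).prodMk
          ((continuous_snd.comp h).comp continuous_snd))
  continuous_inv := by
    have h : Continuous (fun f : X ≃ₜ X =>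
        ((⟨f, f.continuous⟩ : C(X, X)), (⟨f.symm, f.symm.continuous⟩ : C(X, X)))) :=
      continuous_induced_dom
    rw [continuous_induced_rng]
    exact (continuous_snd.comp h).prodMk (continuous_fst.comp h)

section Topological

variable (D : PlanarDatum)

instance : TopologicalSpace D.S := ⊥

instance : DiscreteTopology D.S := ⟨rfl⟩

/-- Pairs of a homeomorphism `f : ℝ → ℝ` with `f (x + 1) = f x ± 1` and an element of `S` over the
sign, i.e. lifts to `ℝ` of the homeomorphisms of `ℝ / ℤ`. -/
def liftGroup : Subgroup ((ℝ ≃ₜ ℝ) × D.S) where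
  carrier := {a | ∀ x : ℝ, a.1 (x + 1) = a.1 x + ((D.χ a.2 : ℤ) : ℝ)}
  one_mem' x := by simp
  mul_mem' := by
    rintro ⟨f, s⟩ ⟨g, t⟩ hf hg x
    simp only [Set.mem_ofPred_eq] at hf hg
    simp only [Prod.mk_mul_mk, Homeomorph.mul_apply, hg]
    rcases sign_cases t with h | h
    · simp [h, hf]
    · have := hf (g x - 1)
      simp only [sub_add_cancel] at this
      simp only [h, map_mul, Units.val_neg, Units.val_one, Int.cast_neg, Int.cast_one, mul_neg,
        mul_one, this, ← sub_eq_add_neg]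
      ring
  inv_mem' := by
    rintro ⟨f, s⟩ hf x
    simp only [Set.mem_ofPred_eq] at hf
    simp only [Prod.fst_inv, Prod.snd_inv, Homeomorph.inv_apply, map_inv, Int.units_inv_eq_self]
    rw [Homeomorph.symm_apply_eq]
    rcases sign_cases s with h | h
    · simp [h, hf]
    · have := hf (f.symm x - 1)
      simp only [h, sub_add_cancel, Homeomorph.apply_symm_apply] at this
      simp only [h, Units.val_neg, Units.val_one, Int.cast_neg, Int.cast_one,
        ← sub_eq_add_neg] at this ⊢
      linarith

variable {D}

theorem lift_add_nat (a : liftGroup D) (x : ℝ) (k : ℕ) :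
    a.1.1 (x + k) = a.1.1 x + ((D.χ a.1.2 : ℤ) : ℝ) * k := by
  induction k with
  | zero => simp
  | succ k ih =>
    have := a.2 (x + k)
    rw [ih] at this
    push_cast
    rw [← add_assoc, this]
    ring

variable (D)

/-- The translation by `N` full turns, paired with `z`. -/
def deckGenerator : liftGroup D :=
  ⟨(Homeomorph.addRight (D.N : ℝ), D.z), fun x => by simp [D.sign_z]; ring⟩

/-- The subgroup of lifts that are identified with the identity. -/
def deckGroup : Subgroup (liftGroup D) := Subgroup.zpowers (deckGenerator D)

theorem deck_conj (a : liftGroup D) :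
    a * deckGenerator D * a⁻¹ = deckGenerator D ^ (D.χ a.1.2 : ℤ) := by
  have hz : D.z⁻¹ = D.z := inv_eq_of_mul_eq_one_left D.sq_z
  rcases sign_cases a.1.2 with h | h
  · rw [mul_inv_eq_iff_eq_mul, h]
    simp only [Units.val_one, zpow_one]
    refine Subtype.ext (Prod.ext (Homeomorph.ext fun x => ?_) (mul_comm _ _))
    change a.1.1 (x + (D.N : ℝ)) = a.1.1 x + D.N
    rw [lift_add_nat, h]; simp
  · rw [mul_inv_eq_iff_eq_mul, h]
    simp only [Units.val_neg, Units.val_one, zpow_neg, zpow_one]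
    refine Subtype.ext (Prod.ext (Homeomorph.ext fun x => ?_) ?_)
    · change a.1.1 (x + (D.N : ℝ)) = a.1.1 x + -(D.N : ℝ)
      rw [lift_add_nat, h]; simp
    · change a.1.2 * D.z = D.z⁻¹ * a.1.2
      rw [hz, mul_comm]

instance : (deckGroup D).Normal where
  conj_mem := by
    rintro _ ⟨k, rfl⟩ a
    refine ⟨(D.χ a.1.2 : ℤ) * k, ?_⟩
    simp only
    rw [zpow_mul, ← deck_conj, conj_zpow]

/-- The planar homeomorphism group `Homeo^G(S¹)`: the connective covering of the homeomorphism
group of the circle that restricts to the planar Lie group `G → O(2)` over the isometries. The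
group `G` itself is the subgroup of the classes of the pairs whose first entry has the form
`x ↦ c ± x`. -/
abbrev HomeoG : Type := liftGroup D ⧸ deckGroup D

/-- The standard circle, `ℝ / ℤ`. -/
abbrev S1 : Type := UnitAddCircle

/-- The continuous map of `ℝ / ℤ` induced by a lift. -/
def descend (a : liftGroup D) : S1 → S1 :=
  Function.Periodic.lift (f := fun x : ℝ => ((a.1.1 x : ℝ) : S1)) (c := 1) (by
    intro x
    change ((a.1.1 (x + 1) : ℝ) : S1) = ((a.1.1 x : ℝ) : S1)
    rw [a.2 x, AddCircle.coe_add]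
    rcases sign_cases a.1.2 with h | h <;> simp [h])

theorem continuous_descend (a : liftGroup D) : Continuous (descend D a) := by
  refine continuous_coinduced_dom.2 ?_
  exact (AddCircle.continuous_mk' 1).comp a.1.1.continuous

theorem descend_mul (a b : liftGroup D) (x : S1) :
    descend D (a * b) x = descend D a (descend D b x) := by
  induction x using QuotientAddGroup.induction_on
  rfl

theorem descend_one (x : S1) : descend D 1 x = x := by
  induction x using QuotientAddGroup.induction_on
  rfl

def liftToHomeo : liftGroup D →* (S1 ≃ₜ S1) where
  toFun a :=
    { toFun := descend D a
      invFun := descend D a⁻¹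
      left_inv := fun x => by rw [← descend_mul, inv_mul_cancel, descend_one]
      right_inv := fun x => by rw [← descend_mul, mul_inv_cancel, descend_one]
      continuous_toFun := continuous_descend D a
      continuous_invFun := continuous_descend D a⁻¹ }
  map_one' := Homeomorph.ext (descend_one D)
  map_mul' a b := Homeomorph.ext (descend_mul D a b)

/-- The projection `p : Homeo^G(S¹) → Homeo(S¹)`. -/
def toHomeo : HomeoG D →* (S1 ≃ₜ S1) :=
  QuotientGroup.lift (deckGroup D) (liftToHomeo D) (by
    rintro _ ⟨k, rfl⟩
    have : liftToHomeo D (deckGenerator D) = 1 := by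
      refine Homeomorph.ext fun x => ?_
      induction x using QuotientAddGroup.induction_on with
      | H y =>
        change (((y + (D.N : ℝ) : ℝ)) : S1) = (y : S1)
        rw [AddCircle.coe_add]
        have h : (((D.N : ℝ)) : S1) = 0 := by
          rw [AddCircle.coe_eq_zero_iff]
          exact ⟨D.N, by simp⟩
        rw [h, add_zero]
    change liftToHomeo D (deckGenerator D ^ k) = 1
    rw [map_zpow, this, one_zpow])

/-! ### Structured marked circles -/

/-- A `G`-structured circle: a space `C` homeomorphic to the circle with a reduction
`ρ : F → Homeo(S¹, C)` of the structure group along `p`. Here `F` is a (right, topological) torsor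
under `Homeo^G(S¹)`, and `ρ` is equivariant (hence automatically continuous). -/
structure StructuredCircle where
  C : Type
  [topC : TopologicalSpace C]
  isCircle : Nonempty (S1 ≃ₜ C)
  F : Type
  [topF : TopologicalSpace F]
  [action : MulAction (HomeoG D)ᵐᵒᵖ F]
  nonempty : Nonempty F
  torsor : ∀ f : F, IsHomeomorph (fun h : HomeoG D => MulOpposite.op h • f)
  ρ : F → (S1 ≃ₜ C)
  ρ_smul : ∀ (h : HomeoG D) (f : F), ρ (MulOpposite.op h • f) = (toHomeo D h).trans (ρ f)

attribute [instance] StructuredCircle.topC StructuredCircle.topF StructuredCircle.action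

/-- A nonempty closed subset homeomorphic to a finite disjoint union of intervals. -/
def IsMarking {C : Type*} [TopologicalSpace C] (J : Set C) : Prop :=
  IsClosed J ∧ J.Nonempty ∧ ∃ k : ℕ, Nonempty (J ≃ₜ Fin k × unitInterval)

/-- A `G`-structured marked circle `(C, J)`. -/
structure MarkedCircle extends StructuredCircle D where
  J : Set C
  marking : IsMarking J

variable {D}

/-- The points `(φ, φ̃)` of `Homeo^G((C, J), (C', J'))`. -/
@[ext]
structure MarkedHomeo (X Y : MarkedCircle D) where
  φ : X.C ≃ₜ Y.C
  φt : X.F ≃ₜ Y.F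
  equivariant : ∀ (h : HomeoG D) (f : X.F),
    φt (MulOpposite.op h • f) = MulOpposite.op h • φt f
  comm : ∀ f : X.F, Y.ρ (φt f) = (X.ρ f).trans φ
  maps : Set.MapsTo φ X.J Y.J

/-- The topology on `Homeo^G((C, J), (C', J'))`, for which `(φ, φ̃) ↦ φ̃ f ∈ F' ≅ Homeo^G(S¹)`
is an embedding for each `f ∈ F`. -/
instance (X Y : MarkedCircle D) : TopologicalSpace (MarkedHomeo X Y) :=
  TopologicalSpace.induced (fun a => (a.φt : X.F → Y.F)) inferInstance

namespace MarkedHomeo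

def id (X : MarkedCircle D) : MarkedHomeo X X where
  φ := Homeomorph.refl _
  φt := Homeomorph.refl _
  equivariant _ _ := rfl
  comm _ := rfl
  maps _ hx := hx

def comp {X Y Z : MarkedCircle D} (a : MarkedHomeo X Y) (b : MarkedHomeo Y Z) :
    MarkedHomeo X Z where
  φ := a.φ.trans b.φ
  φt := a.φt.trans b.φt
  equivariant h f := by simp [a.equivariant, b.equivariant]
  comm f := by
    rw [Homeomorph.trans_apply, b.comm, a.comm]
    rfl
  maps := b.maps.comp a.maps

theorem continuous_eval {X Y : MarkedCircle D} (f : X.F) :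
    Continuous (fun a : MarkedHomeo X Y => a.φt f) :=
  (continuous_apply f).comp continuous_induced_dom

theorem continuous_iff {X Y : MarkedCircle D} {W : Type*} [TopologicalSpace W]
    {u : W → MarkedHomeo X Y} : Continuous u ↔ ∀ f, Continuous (fun w => (u w).φt f) := by
  rw [continuous_induced_rng, continuous_pi_iff]
  rfl

theorem comp_joined {X Y Z : MarkedCircle D} {a a' : MarkedHomeo X Y} {b b' : MarkedHomeo Y Z}
    (ha : Joined a a') (hb : Joined b b') : Joined (a.comp b) (a'.comp b') := by
  have h1 : Continuous (fun c : MarkedHomeo X Y => c.comp b) :=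
    continuous_iff.2 fun f => b.φt.continuous.comp (continuous_eval f)
  have h2 : Continuous (fun c : MarkedHomeo Y Z => a'.comp c) :=
    continuous_iff.2 fun f => continuous_eval (a'.φt f)
  exact (ha.map h1).trans (hb.map h2)

end MarkedHomeo

/-- The category of `G`-structured marked circles, with
`Hom((C, J), (C', J')) = π₀ Homeo^G((C, J), (C', J'))`. -/
instance : Category (MarkedCircle D) where
  Hom X Y := ZerothHomotopy (MarkedHomeo X Y)
  id X := ZerothHomotopy.mk (MarkedHomeo.id X)
  comp f g := Quotient.map₂ MarkedHomeo.comp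
    (fun _ _ ha _ _ hb => MarkedHomeo.comp_joined ha hb) f g
  id_comp f := by
    induction f using Quotient.inductionOn
    rfl
  comp_id f := by
    induction f using Quotient.inductionOn
    rfl
  assoc f g h := by
    induction f using Quotient.inductionOn
    induction g using Quotient.inductionOn
    induction h using Quotient.inductionOn
    rfl

/-! ### Interstice duality -/

/-- `(C, J)^∨ = (C, closure (C ∖ J))`. -/
def MarkedCircle.dual (X : MarkedCircle D) (h : IsMarking (closure X.Jᶜ)) : MarkedCircle D where
  toStructuredCircle := X.toStructuredCircle
  J := closure X.Jᶜ
  marking := h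

theorem MarkedHomeo.symm_equivariant {X Y : MarkedCircle D} (a : MarkedHomeo X Y)
    (h : HomeoG D) (f : Y.F) :
    a.φt.symm (MulOpposite.op h • f) = MulOpposite.op h • a.φt.symm f := by
  rw [Homeomorph.symm_apply_eq, a.equivariant, Homeomorph.apply_symm_apply]

theorem MarkedHomeo.symm_comm {X Y : MarkedCircle D} (a : MarkedHomeo X Y) (f : Y.F) :
    X.ρ (a.φt.symm f) = (Y.ρ f).trans a.φ.symm := by
  have := a.comm (a.φt.symm f)
  rw [Homeomorph.apply_symm_apply] at this
  rw [this]
  ext x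
  simp

theorem MarkedHomeo.symm_maps {X Y : MarkedCircle D} (a : MarkedHomeo X Y) :
    Set.MapsTo a.φ.symm (closure Y.Jᶜ) (closure X.Jᶜ) := by
  refine Set.MapsTo.closure (fun y hy hx => hy ?_) a.φ.symm.continuous
  have := a.maps hx
  rwa [Homeomorph.apply_symm_apply] at this

theorem MarkedHomeo.continuous_symm {X Y : MarkedCircle D} (f : Y.F) :
    Continuous fun a : MarkedHomeo X Y => a.φt.symm f := by
  obtain ⟨e⟩ := X.nonempty
  let θ : HomeoG D ≃ₜ Y.F := (Y.torsor f).homeomorph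
  have hform : ∀ a : MarkedHomeo X Y,
      a.φt.symm f = MulOpposite.op (θ.symm (a.φt e))⁻¹ • e := by
    intro a
    have h1 : MulOpposite.op (θ.symm (a.φt e)) • f = a.φt e := θ.apply_symm_apply (a.φt e)
    rw [Homeomorph.symm_apply_eq, a.equivariant, ← h1, smul_smul, MulOpposite.op_inv,
      h1, inv_mul_cancel, one_smul]
  simp_rw [hform]
  exact (X.torsor e).continuous.comp
    ((θ.symm.continuous.comp (MarkedHomeo.continuous_eval e)).inv)

/-- `(φ, φ̃)^∨ = (φ⁻¹, φ̃⁻¹)`. -/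
def MarkedHomeo.dual {X Y : MarkedCircle D} (hX : IsMarking (closure X.Jᶜ))
    (hY : IsMarking (closure Y.Jᶜ)) (a : MarkedHomeo X Y) :
    MarkedHomeo (Y.dual hY) (X.dual hX) where
  φ := a.φ.symm
  φt := a.φt.symm
  equivariant := a.symm_equivariant
  comm := a.symm_comm
  maps := a.symm_maps

theorem MarkedHomeo.continuous_dual {X Y : MarkedCircle D} (hX : IsMarking (closure X.Jᶜ))
    (hY : IsMarking (closure Y.Jᶜ)) :
    Continuous (MarkedHomeo.dual (X := X) (Y := Y) hX hY) :=
  MarkedHomeo.continuous_iff.2 fun f => MarkedHomeo.continuous_symm (X := X) (Y := Y) f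

/-- The interstice duality functor `(C, J) ↦ (C, closure (C ∖ J))`,
`[(φ, φ̃)] ↦ [(φ⁻¹, φ̃⁻¹)]`. -/
def interstice (h : ∀ X : MarkedCircle D, IsMarking (closure X.Jᶜ)) :
    MarkedCircle D ⥤ (MarkedCircle D)ᵒᵖ where
  obj X := Opposite.op (X.dual (h X))
  map {X Y} f := Quiver.Hom.op (X := Y.dual (h Y)) (Y := X.dual (h X))
    (Quotient.map (MarkedHomeo.dual (h X) (h Y))
      (fun _ _ hab => Joined.map hab (MarkedHomeo.continuous_dual (h X) (h Y))) f)
  map_id X := rfl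
  map_comp f g := by
    induction f using Quotient.inductionOn
    induction g using Quotient.inductionOn
    rfl

end Topological

/-- The category of structured marked circles for the planar Lie group of type `T`. -/
abbrev Circles (T : PlanarType) : Type 1 := MarkedCircle T.datum

end

end PlanarDuality

open PlanarDuality

namespace PlanarDuality

noncomputable section

/-! The marked circles are a topological model of the planar crossed simplicial group, and in this
model the duality is visible: if `φ` maps `J` into `J'`, then `φ⁻¹` maps the complement of `J'` into
that of `J`, hence also the closures. A marking is the closure of the complement of its interstices
(`closure_compl_closure_compl`), so the construction can be undone, and inversion is continuous, so
it descends to `π₀`.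

The comparison of the two models rests on three facts. A frame can be chosen in which `J` becomes
the standard marking, whose components lift to the intervals from `l / (n + 1)` to `(l + 1 / 2) / (n
+ 1)` (`exists_frame`). A lift that respects standard markings sends each of these intervals into
one of the target, and the indices form a periodic monotone map, which is constant along paths
(`floorClass_eq_of_path`). Conversely, every periodic monotone map arises in this way
(`exists_lift_floorMap_eq`), and the lifts inducing the same one form a convex set
(`exists_path_of_floorMap_eq`). Thus `π₀` of the space of marked homeomorphisms is the combinatorial
Hom set.

A circle with `n + 1` marked intervals has `n + 1` interstices, so the transported duality sends
`[n]` to an object isomorphic to `[n]`; changing it along these isomorphisms makes it the identity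
on objects. -/

/-! ### Increasing maps of the line -/

/-- A strictly increasing sequence with `c (j + p) = c j + q` passes every real number. -/
theorem exists_int_mem_Ico (c : ℤ → ℝ) (hc : StrictMono c) (p : ℕ) (hp : 0 < p) (q : ℝ)
    (hper : ∀ j, c (j + p) = c j + q) (w : ℝ) : ∃ j : ℤ, c j ≤ w ∧ w < c (j + 1) := by
  have hq : 0 < q := by
    have h := hc (show (0 : ℤ) < 0 + p by omega)
    rw [hper] at h
    linarith
  -- Along the multiples of `p` the sequence is affine, so a floor of `(w - c 0) / q` yields both an
  -- index below `w` and a bound on all such indices.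
  have hmul : ∀ k : ℤ, c (k * p) = c 0 + k * q := by
    intro k
    induction k using Int.induction_on with
    | zero => simp
    | succ i ih =>
      rw [add_mul, one_mul, hper, ih]
      push_cast
      ring
    | pred i ih =>
      have h := hper ((-(i : ℤ) - 1) * p)
      rw [show (-(i : ℤ) - 1) * p + p = -(i : ℤ) * p by ring, ih] at h
      push_cast at h ⊢
      linarith
  have hlow : ∃ j : ℤ, c j ≤ w := by
    refine ⟨⌊(w - c 0) / q⌋ * p, ?_⟩
    rw [hmul]
    have h := mul_le_mul_of_nonneg_right (Int.floor_le ((w - c 0) / q)) hq.le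
    rw [div_mul_cancel₀ _ hq.ne'] at h
    linarith
  have hup : ∃ b : ℤ, ∀ j : ℤ, c j ≤ w → j ≤ b := by
    refine ⟨(⌊(w - c 0) / q⌋ + 1) * p, fun j hj => ?_⟩
    by_contra! hlt
    have h1 := hc hlt
    rw [hmul] at h1
    have h := mul_lt_mul_of_pos_right (Int.lt_floor_add_one ((w - c 0) / q)) hq
    rw [div_mul_cancel₀ _ hq.ne'] at h
    push_cast at h1
    linarith
  obtain ⟨j, hj, hmax⟩ := Int.exists_greatest_of_bdd hup hlow
  refine ⟨j, hj, ?_⟩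
  by_contra! h
  have := hmax _ h
  omega

/-- Piecewise linear interpolation of a quasiperiodic strictly increasing sequence. -/
theorem exists_orderIso_interpolating (c : ℤ → ℝ) (hc : StrictMono c) (p : ℕ) (hp : 0 < p)
    (q : ℝ) (hper : ∀ j, c (j + p) = c j + q) :
    ∃ g : ℝ ≃o ℝ, (∀ j : ℤ, g j = c j) ∧ ∀ y, g (y + p) = g y + q := by
  let g : ℝ → ℝ := fun y => c ⌊y⌋ + Int.fract y * (c (⌊y⌋ + 1) - c ⌊y⌋)
  have hpos : ∀ j, 0 < c (j + 1) - c j := fun j => sub_pos.2 (hc (lt_add_one j))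
  have hmono : StrictMono g := by
    intro y z hyz
    rcases (Int.floor_mono hyz.le).eq_or_lt with h | h
    · have hf : Int.fract y < Int.fract z := by
        unfold Int.fract
        rw [h]
        linarith
      have := mul_lt_mul_of_pos_right hf (hpos ⌊z⌋)
      simp only [g, h]
      linarith
    · have h1 : g y < c (⌊y⌋ + 1) := by
        have := mul_lt_mul_of_pos_right (Int.fract_lt_one y) (hpos ⌊y⌋)
        simp only [g]
        linarith
      have h2 : c (⌊y⌋ + 1) ≤ c ⌊z⌋ := hc.monotone h
      have h3 : c ⌊z⌋ ≤ g z := by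
        have := mul_nonneg (Int.fract_nonneg z) (hpos ⌊z⌋).le
        simp only [g]
        linarith
      linarith
  have hsurj : Function.Surjective g := by
    intro w
    obtain ⟨j, h1, h2⟩ := exists_int_mem_Ico c hc p hp q hper w
    have h0 : 0 ≤ (w - c j) / (c (j + 1) - c j) := div_nonneg (sub_nonneg.2 h1) (hpos j).le
    have h3 : (w - c j) / (c (j + 1) - c j) < 1 := (div_lt_one (hpos j)).2 (by linarith)
    have hfl : ⌊(j : ℝ) + (w - c j) / (c (j + 1) - c j)⌋ = j := by
      rw [Int.floor_eq_iff]
      constructor <;> linarith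
    refine ⟨j + (w - c j) / (c (j + 1) - c j), ?_⟩
    simp only [g, Int.fract, hfl]
    rw [add_sub_cancel_left, div_mul_cancel₀ _ (hpos j).ne']
    ring
  refine ⟨hmono.orderIsoOfSurjective g hsurj, fun j => ?_, fun y => ?_⟩
  · simp [g]
  · have h1 := hper ⌊y⌋
    have h2 := hper (⌊y⌋ + 1)
    rw [add_right_comm] at h2
    simp only [StrictMono.coe_orderIsoOfSurjective, g, Int.floor_add_natCast,
      Int.fract_add_natCast, h1, h2]
    ring

/-- A family of increasing homeomorphisms of the line is continuous as soon as it is jointly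
continuous: the inverses depend continuously on the parameter. -/
theorem continuous_homeo_of_strictMono {W : Type*} [TopologicalSpace W] (u : W → (ℝ ≃ₜ ℝ))
    (hmono : ∀ w, StrictMono (u w)) (hu : Continuous fun x : W × ℝ => u x.1 x.2) :
    Continuous u := by
  have hinv : Continuous fun x : W × ℝ => (u x.1).symm x.2 := by
    rw [continuous_iff_continuousAt]
    rintro ⟨w, y⟩
    -- For an increasing `u w`, the bounds `a < (u w).symm y < b` mean `u w a < y < u w b`. This
    -- involves evaluation at two fixed points only, and is an open condition on `(w, y)`.
    have key : ∀ ε > 0, ∀ᶠ x : W × ℝ in 𝓝 (w, y),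
        (u w).symm y - ε < (u x.1).symm x.2 ∧ (u x.1).symm x.2 < (u w).symm y + ε := by
      intro ε hε
      have hlt : ∀ (v : W) (a b : ℝ), u v a < b ↔ a < (u v).symm b := fun v a b => by
        rw [← (hmono v).lt_iff_lt (a := a), Homeomorph.apply_symm_apply]
      have hgt : ∀ (v : W) (a b : ℝ), b < u v a ↔ (u v).symm b < a := fun v a b => by
        rw [← (hmono v).lt_iff_lt (b := a), Homeomorph.apply_symm_apply]
      have h1 : ∀ a : ℝ, Continuous fun x : W × ℝ => u x.1 a := fun a =>
        hu.comp (continuous_fst.prodMk continuous_const)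
      have e1 := (h1 ((u w).symm y - ε)).continuousAt.eventually_lt
        (continuous_snd.continuousAt (x := (w, y))) ((hlt _ _ _).2 (by simp [hε]))
      have e2 := (continuous_snd.continuousAt (x := (w, y))).eventually_lt
        (h1 ((u w).symm y + ε)).continuousAt ((hgt _ _ _).2 (by simp [hε]))
      filter_upwards [e1, e2] with x hx1 hx2
      exact ⟨(hlt _ _ _).1 hx1, (hgt _ _ _).1 hx2⟩
    rw [ContinuousAt, Metric.tendsto_nhds]
    intro ε hε
    filter_upwards [key ε hε] with x hx
    rw [Real.dist_eq, abs_lt]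
    constructor <;> linarith [hx.1, hx.2]
  rw [continuous_induced_rng]
  exact Continuous.prodMk (ContinuousMap.continuous_of_continuous_uncurry _ hu)
    (ContinuousMap.continuous_of_continuous_uncurry _ hinv)

/-! ### The standard marking of the line -/

theorem fract_le_half_iff (y : ℝ) :
    Int.fract y ≤ 1 / 2 ↔ ∃ k : ℤ, (k : ℝ) ≤ y ∧ y ≤ k + 1 / 2 := by
  constructor
  · intro h
    refine ⟨⌊y⌋, Int.floor_le y, ?_⟩
    have := Int.floor_add_fract y
    linarith
  · rintro ⟨k, h1, h2⟩
    have : ⌊y⌋ = k := Int.floor_eq_iff.2 ⟨h1, by linarith⟩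
    rw [Int.fract, this]
    linarith

theorem le_floor_add_half {y : ℝ} (h : Int.fract y ≤ 1 / 2) : y ≤ ⌊y⌋ + 1 / 2 := by
  have := Int.floor_add_fract y
  linarith

/-- Distinct intervals `[k, k + 1/2]` are separated by gaps of length at least `1/2`. -/
theorem floor_eq_of_abs_sub_lt {y z : ℝ} (hy : Int.fract y ≤ 1 / 2) (hz : Int.fract z ≤ 1 / 2)
    (h : |y - z| < 1 / 2) : ⌊y⌋ = ⌊z⌋ := by
  have key : ∀ {y z : ℝ}, Int.fract y ≤ 1 / 2 → |y - z| < 1 / 2 → ⌊z⌋ ≤ ⌊y⌋ := by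
    intro y z hy h
    by_contra! hlt
    have h1 : (⌊y⌋ : ℝ) + 1 ≤ ⌊z⌋ := by exact_mod_cast hlt
    have h2 := le_floor_add_half hy
    have h3 := Int.floor_le z
    have h4 := (abs_lt.1 h).1
    linarith
  exact le_antisymm (key hz (by rwa [abs_sub_comm])) (key hy h)

/-- On a connected set, a continuous function with values in the marking stays in one
component. -/
theorem floor_eq_of_isPreconnected {s : Set ℝ} (hs : _root_.IsPreconnected s) {f : ℝ → ℝ}
    (hf : ContinuousOn f s) (h : ∀ x ∈ s, Int.fract (f x) ≤ 1 / 2) {x y : ℝ} (hx : x ∈ s)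
    (hy : y ∈ s) : ⌊f x⌋ = ⌊f y⌋ := by
  have key : ∀ {x y : ℝ}, x ∈ s → y ∈ s → ⌊f y⌋ ≤ ⌊f x⌋ := by
    intro x y hx hy
    by_contra! hlt
    have h1 : (⌊f x⌋ : ℝ) + 1 ≤ ⌊f y⌋ := by exact_mod_cast hlt
    have h2 := le_floor_add_half (h x hx)
    have h3 := Int.floor_le (f y)
    -- The value `⌊f x⌋ + 3/4` lies in a gap of the marking, yet a jump of the floor would force `f`
    -- to take it.
    obtain ⟨t, ht, hft⟩ := hs.intermediate_value hx hy hf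
      (show (⌊f x⌋ : ℝ) + 3 / 4 ∈ Set.Icc (f x) (f y) by constructor <;> linarith)
    have h4 := h t ht
    have h5 : ⌊f t⌋ = ⌊f x⌋ := by
      rw [hft, Int.floor_eq_iff]
      constructor <;> linarith
    have h6 := Int.floor_add_fract (f t)
    rw [h5] at h6
    linarith
  exact le_antisymm (key hy hx) (key hx hy)

/-! ### Realization of monotone periodic maps -/

theorem exists_bound_of_periodic (d : ℤ → ℝ) (p : ℕ) (hp : 0 < p) (h : ∀ j, d (j + p) = d j) :
    ∃ B : ℝ, 1 ≤ B ∧ ∀ j, |d j| ≤ B := by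
  have hper : Function.Periodic d (p : ℤ) := h
  have hfin : (d '' Set.Ico 0 (p : ℤ)).Finite := (Set.finite_Ico _ _).image d
  obtain ⟨B, hB⟩ := (hfin.image fun x => |x|).bddAbove
  refine ⟨max B 1, le_max_right _ _, fun j => ?_⟩
  have hj : d j = d (j % p) := by
    conv_lhs => rw [← Int.emod_add_mul_ediv j p, mul_comm]
    exact hper.int_mul _ _
  refine le_max_of_le_left (hB ⟨d (j % p), ⟨j % p, ⟨?_, ?_⟩, rfl⟩, ?_⟩)
  · exact Int.emod_nonneg _ (by omega)
  · exact Int.emod_lt_of_pos _ (by omega)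
  · simp only [hj]

/-- `F` may be constant on long stretches, so it is mixed with a small multiple of the linear
function `lam` that has the same growth per period. The result `c` is strictly increasing; `c (2 *
l)` and `c (2 * l + 1)` serve as the values at the endpoints `l` and `l + 1/2`, with interpolation
in between. -/
theorem exists_orderIso_of_monotone (m n : ℕ) (F : ℤ → ℤ) (hF : Monotone F)
    (hper : ∀ l, F (l + (m + 1)) = F l + (n + 1)) :
    ∃ g : ℝ ≃o ℝ, (∀ y, g (y + (m + 1)) = g y + (n + 1)) ∧
      ∀ (l : ℤ) (y : ℝ), (l : ℝ) ≤ y → y ≤ l + 1 / 2 → (F l : ℝ) ≤ g y ∧ g y ≤ F l + 1 / 2 := by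
  have hhalf : ∀ j : ℤ, (j + (2 * (m + 1) : ℕ)) / 2 = j / 2 + (m + 1) := fun j => by
    push_cast
    omega
  let lam : ℤ → ℝ := fun j => j * ((n + 1) / (2 * (m + 1)))
  have hm : (0 : ℝ) < 2 * (m + 1) := by positivity
  have hlam : ∀ j, lam (j + (2 * (m + 1) : ℕ)) = lam j + (n + 1) := fun j => by
    simp only [lam]
    push_cast
    field_simp
  have hlam' : StrictMono lam := fun i j hij => by
    have : (i : ℝ) < j := by exact_mod_cast hij
    exact mul_lt_mul_of_pos_right this (by positivity)
  obtain ⟨B, hB1, hB⟩ := exists_bound_of_periodic (fun j => lam j - F (j / 2)) (2 * (m + 1))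
    (by positivity) (fun j => by
      rw [hlam, hhalf, hper]
      push_cast
      ring)
  have hB0 : 0 < B := by linarith
  -- Since `|lam j - F (j / 2)| ≤ B`, the shifted difference lies in `[0, 2 * B]`, and `ε` scales it
  -- into `[0, 1/2]`. The bound `1 ≤ B` gives `ε < 1`, so that `F` enters `c` with the positive
  -- coefficient `1 - ε`.
  let ε : ℝ := 1 / (4 * B)
  have hε : 0 < ε := by positivity
  have hεB : ε * B = 1 / 4 := by
    simp only [ε]
    field_simp
  have hε1 : ε < 1 := by nlinarith
  let c : ℤ → ℝ := fun j => F (j / 2) + ε * (lam j - F (j / 2) + B)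
  have hc : StrictMono c := by
    intro i j hij
    have h1 : (F (i / 2) : ℝ) ≤ F (j / 2) := by
      exact_mod_cast hF (Int.ediv_le_ediv (by norm_num) hij.le)
    have h2 := mul_lt_mul_of_pos_left (hlam' hij) hε
    have h3 := mul_le_mul_of_nonneg_left h1 (sub_pos.2 hε1).le
    simp only [c]
    linarith
  have hcB : ∀ j, (F (j / 2) : ℝ) ≤ c j ∧ c j ≤ F (j / 2) + 1 / 2 := fun j => by
    obtain ⟨h1, h2⟩ := abs_le.1 (hB j)
    have h3 := mul_le_mul_of_nonneg_left h1 hε.le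
    have h4 := mul_le_mul_of_nonneg_left h2 hε.le
    simp only [c]
    constructor <;> nlinarith
  obtain ⟨g, hg, hgper⟩ := exists_orderIso_interpolating c hc (2 * (m + 1)) (by positivity)
    (n + 1) (fun j => by
      simp only [c]
      rw [hlam, hhalf, hper]
      push_cast
      ring)
  -- The interpolant has its nodes at the integers, the endpoints of the marking are the
  -- half-integers; hence the doubling.
  refine ⟨(OrderIso.mulLeft₀ (2 : ℝ) two_pos).trans g, fun y => ?_, fun l y h1 h2 => ?_⟩
  · simp only [OrderIso.trans_apply, OrderIso.mulLeft₀_apply]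
    rw [← hgper]
    congr 1
    push_cast
    ring
  · simp only [OrderIso.trans_apply, OrderIso.mulLeft₀_apply]
    have h3 : g ((2 * l : ℤ) : ℝ) ≤ g (2 * y) := g.monotone (by push_cast; linarith)
    have h4 : g (2 * y) ≤ g ((2 * l + 1 : ℤ) : ℝ) := g.monotone (by push_cast; linarith)
    rw [hg] at h3 h4
    have h5 := (hcB (2 * l)).1
    have h6 := (hcB (2 * l + 1)).2
    rw [show (2 * l) / 2 = l by omega] at h5
    rw [show (2 * l + 1) / 2 = l by omega] at h6
    exact ⟨h5.trans h3, h4.trans h6⟩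

/-! ### Linear interpolation of homeomorphisms -/

/-- Increasing homeomorphisms form a convex set: a convex combination is at most `y` at the smaller
of the two preimages of `y` and at least `y` at the larger, so it is onto by the intermediate value
theorem. -/
theorem exists_homeo_lerp_of_strictMono (f g : ℝ ≃ₜ ℝ) (hf : StrictMono f) (hg : StrictMono g) :
    ∃ u : unitInterval → (ℝ ≃ₜ ℝ), Continuous u ∧
      ∀ t x, u t x = (1 - (t : ℝ)) * f x + t * g x := by
  have hmono : ∀ t : unitInterval, StrictMono fun x => (1 - (t : ℝ)) * f x + t * g x := by
    intro t x y hxy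
    have h1 := mul_le_mul_of_nonneg_left (hf hxy).le (sub_nonneg.2 t.2.2)
    have h2 := mul_le_mul_of_nonneg_left (hg hxy).le t.2.1
    -- At `t = 0` the strictness comes from `f`, otherwise from `g`.
    rcases t.2.1.eq_or_lt with h | h
    · simp only [← h]
      linarith [hf hxy]
    · have h3 := mul_lt_mul_of_pos_left (hg hxy) h
      simp only
      linarith
  have hcont : ∀ t : unitInterval, Continuous fun x => (1 - (t : ℝ)) * f x + t * g x :=
    fun t => (continuous_const.mul f.continuous).add (continuous_const.mul g.continuous)
  have hsurj : ∀ t : unitInterval,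
      Function.Surjective fun x => (1 - (t : ℝ)) * f x + t * g x := by
    intro t y
    have hl : (1 - (t : ℝ)) * f (min (f.symm y) (g.symm y))
        + t * g (min (f.symm y) (g.symm y)) ≤ y := by
      have h1 : f (min (f.symm y) (g.symm y)) ≤ y := by
        simpa using hf.monotone (min_le_left (f.symm y) (g.symm y))
      have h2 : g (min (f.symm y) (g.symm y)) ≤ y := by
        simpa using hg.monotone (min_le_right (f.symm y) (g.symm y))
      have h3 := mul_le_mul_of_nonneg_left h1 (sub_nonneg.2 t.2.2)
      have h4 := mul_le_mul_of_nonneg_left h2 t.2.1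
      linarith
    have hu : y ≤ (1 - (t : ℝ)) * f (max (f.symm y) (g.symm y))
        + t * g (max (f.symm y) (g.symm y)) := by
      have h1 : y ≤ f (max (f.symm y) (g.symm y)) := by
        simpa using hf.monotone (le_max_left (f.symm y) (g.symm y))
      have h2 : y ≤ g (max (f.symm y) (g.symm y)) := by
        simpa using hg.monotone (le_max_right (f.symm y) (g.symm y))
      have h3 := mul_le_mul_of_nonneg_left h1 (sub_nonneg.2 t.2.2)
      have h4 := mul_le_mul_of_nonneg_left h2 t.2.1
      linarith
    exact mem_range_of_exists_le_of_exists_ge (hcont t) ⟨_, hl⟩ ⟨_, hu⟩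
  refine ⟨fun t => ((hmono t).orderIsoOfSurjective _ (hsurj t)).toHomeomorph, ?_,
    fun t x => rfl⟩
  refine continuous_homeo_of_strictMono _ (fun t => hmono t) ?_
  change Continuous fun x : unitInterval × ℝ => (1 - (x.1 : ℝ)) * f x.2 + x.1 * g x.2
  have h1 : Continuous fun x : unitInterval × ℝ => (x.1 : ℝ) :=
    continuous_subtype_val.comp continuous_fst
  exact ((continuous_const.sub h1).mul (f.continuous.comp continuous_snd)).add
    (h1.mul (g.continuous.comp continuous_snd))

theorem exists_homeo_lerp_of_strictAnti (f g : ℝ ≃ₜ ℝ) (hf : StrictAnti f) (hg : StrictAnti g) :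
    ∃ u : unitInterval → (ℝ ≃ₜ ℝ), Continuous u ∧
      ∀ t x, u t x = (1 - (t : ℝ)) * f x + t * g x := by
  obtain ⟨u, hu, hux⟩ := exists_homeo_lerp_of_strictMono (Homeomorph.neg ℝ * f)
    (Homeomorph.neg ℝ * g) (fun _ _ h => neg_lt_neg (hf h)) (fun _ _ h => neg_lt_neg (hg h))
  refine ⟨fun t => Homeomorph.neg ℝ * u t, continuous_const.mul hu, fun t x => ?_⟩
  simp only [Homeomorph.mul_apply, Homeomorph.coe_neg, hux]
  ring

/-! ### Lifts of homeomorphisms of the circle -/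

variable {D : PlanarDatum}

theorem lift_strictMono (a : liftGroup D) (h : D.χ a.1.2 = 1) : StrictMono a.1.1 := by
  refine (a.1.1.continuous.strictMono_of_inj a.1.1.injective).resolve_right fun hanti => ?_
  have h1 := a.2 0
  have h2 := hanti (show (0 : ℝ) < 0 + 1 by norm_num)
  rw [h] at h1
  simp only [Units.val_one, Int.cast_one] at h1
  linarith

theorem lift_strictAnti (a : liftGroup D) (h : D.χ a.1.2 = -1) : StrictAnti a.1.1 := by
  refine (a.1.1.continuous.strictMono_of_inj a.1.1.injective).resolve_left fun hmono => ?_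
  have h1 := a.2 0
  have h2 := hmono (show (0 : ℝ) < 0 + 1 by norm_num)
  rw [h] at h1
  simp only [Units.val_neg, Units.val_one, Int.cast_neg, Int.cast_one] at h1
  linarith

theorem deckGenerator_zpow_fst (k : ℤ) (x : ℝ) :
    (deckGenerator D ^ k).1.1 x = x + k * D.N := by
  induction k using Int.induction_on generalizing x with
  | zero => simp
  | succ i ih =>
    rw [zpow_add_one]
    change (deckGenerator D ^ (i : ℤ)).1.1 (x + D.N) = _
    rw [ih]
    push_cast
    ring
  | pred i ih =>
    rw [zpow_sub_one]
    change (deckGenerator D ^ (-(i : ℤ))).1.1 (x + -(D.N : ℝ)) = _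
    rw [ih]
    push_cast
    ring

theorem deckGenerator_zpow_snd (k : ℤ) : (deckGenerator D ^ k).1.2 = D.z ^ k :=
  map_zpow ((MonoidHom.snd _ _).comp (liftGroup D).subtype) (deckGenerator D) k

theorem lift_add_int (a : liftGroup D) (x : ℝ) (k : ℤ) :
    a.1.1 (x + k) = a.1.1 x + ((D.χ a.1.2 : ℤ) : ℝ) * k := by
  obtain ⟨k, rfl | rfl⟩ := k.eq_nat_or_neg
  · exact_mod_cast lift_add_nat a x k
  · have h := lift_add_nat a (x + (-(k : ℤ) : ℤ)) k
    rw [show x + ((-(k : ℤ) : ℤ) : ℝ) + k = x by push_cast; ring] at h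
    push_cast at h ⊢
    linarith

/-! ### The standard marking of the circle -/

/-- The standard marking with `n + 1` components. -/
def stdMarking (n : ℕ) : Set S1 :=
  {x | ∃ y : ℝ, (y : S1) = x ∧ Int.fract ((n + 1) * y) ≤ 1 / 2}

theorem coe_eq_coe_iff_exists_int {x y : ℝ} : (x : S1) = (y : S1) ↔ ∃ k : ℤ, x = y + k := by
  rw [← sub_eq_zero, ← AddCircle.coe_sub, AddCircle.coe_eq_zero_iff]
  constructor
  · rintro ⟨k, hk⟩
    exact ⟨k, by simp at hk; linarith⟩
  · rintro ⟨k, hk⟩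
    exact ⟨k, by simp [hk]⟩

theorem coe_mem_stdMarking {n : ℕ} {y : ℝ} :
    (y : S1) ∈ stdMarking n ↔ Int.fract ((n + 1) * y) ≤ 1 / 2 := by
  refine ⟨?_, fun h => ⟨y, rfl, h⟩⟩
  rintro ⟨x, hx, h⟩
  obtain ⟨k, rfl⟩ := coe_eq_coe_iff_exists_int.1 hx
  rwa [show ((n : ℝ) + 1) * (y + k) = (n + 1) * y + (((n + 1) * k : ℤ) : ℝ) by push_cast; ring,
    Int.fract_add_intCast] at h

/-- The classes which map the standard marking with `m + 1` components to the one with `n + 1`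
components. -/
def MapsMarking (m n : ℕ) (h : HomeoG D) : Prop :=
  Set.MapsTo (toHomeo D h) (stdMarking m) (stdMarking n)

theorem mapsMarking_coe {m n : ℕ} {a : liftGroup D} :
    MapsMarking m n (a : HomeoG D) ↔
      ∀ x : ℝ, Int.fract ((m + 1) * x) ≤ 1 / 2 → Int.fract ((n + 1) * a.1.1 x) ≤ 1 / 2 := by
  constructor
  · intro h x hx
    exact coe_mem_stdMarking.1 (h (coe_mem_stdMarking.2 hx))
  · rintro h _ ⟨x, rfl, hx⟩
    exact coe_mem_stdMarking.2 (h x hx)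

/-! ### The combinatorial map of a lift -/

/-- The map of components induced by a lift. -/
def floorMap (m n : ℕ) (a : liftGroup D) : PeriodicMap D m n where
  -- The index is read off at the left endpoint of the `l`-th interval. This makes sense for every
  -- lift, but speaks for the whole interval only if the markings are respected.
  toFun l := ⌊((n : ℝ) + 1) * a.1.1 (l / (m + 1))⌋
  s := a.1.2
  monotone h i j hij := by
    have : (i : ℝ) ≤ j := by exact_mod_cast hij
    have := (lift_strictMono a h).monotone (div_le_div_of_nonneg_right this
      (show (0 : ℝ) ≤ m + 1 by positivity))
    exact Int.floor_mono (mul_le_mul_of_nonneg_left this (by positivity))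
  antitone h i j hij := by
    have : (i : ℝ) ≤ j := by exact_mod_cast hij
    have := (lift_strictAnti a h).antitone (div_le_div_of_nonneg_right this
      (show (0 : ℝ) ≤ m + 1 by positivity))
    exact Int.floor_mono (mul_le_mul_of_nonneg_left this (by positivity))
  periodic l := by
    have h : (((l + (m + 1) : ℤ) : ℝ)) / (m + 1) = l / (m + 1) + 1 := by
      push_cast
      rw [add_div, div_self (by positivity)]
    rw [h, a.2, ← Int.floor_add_intCast]
    congr 1
    push_cast
    ring

/-- An interval of the marking is connected, so its image stays in one component, the one found at
its left endpoint. -/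
theorem floor_apply_eq {m n : ℕ} {a : liftGroup D} (h : MapsMarking m n (a : HomeoG D)) {x : ℝ}
    (hx : Int.fract ((m + 1) * x) ≤ 1 / 2) :
    ⌊((n : ℝ) + 1) * a.1.1 x⌋ = (floorMap m n a).toFun ⌊((m : ℝ) + 1) * x⌋ := by
  have hm : (0 : ℝ) < m + 1 := by positivity
  set k := ⌊((m : ℝ) + 1) * x⌋ with hk
  refine floor_eq_of_isPreconnected (s := Set.Icc ((k : ℝ) / (m + 1)) ((k + 1 / 2) / (m + 1)))
    isPreconnected_Icc (f := fun x => ((n : ℝ) + 1) * a.1.1 x)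
    (continuous_const.mul a.1.1.continuous).continuousOn ?_ ?_ ?_
  · rintro y ⟨h1, h2⟩
    rw [div_le_iff₀ hm] at h1
    rw [le_div_iff₀ hm] at h2
    exact mapsMarking_coe.1 h y ((fract_le_half_iff _).2 ⟨k, by linarith, by linarith⟩)
  · have h1 := Int.floor_le (((m : ℝ) + 1) * x)
    have h2 := le_floor_add_half hx
    rw [← hk] at h1 h2
    constructor
    · rw [div_le_iff₀ hm]
      linarith
    · rw [le_div_iff₀ hm]
      linarith
  · refine ⟨le_rfl, div_le_div_of_nonneg_right (by linarith) hm.le⟩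

theorem floorMap_mul {m n p : ℕ} {a b : liftGroup D} (ha : MapsMarking m n (a : HomeoG D))
    (hb : MapsMarking n p (b : HomeoG D)) :
    floorMap m p (b * a) = (floorMap m n a).comp (floorMap n p b) := by
  refine PeriodicMap.ext (funext fun l => ?_) rfl
  -- `a` sends a left endpoint to some point of a marked interval, not necessarily to its left
  -- endpoint.
  refine floor_apply_eq hb (mapsMarking_coe.1 ha _ ?_)
  rw [mul_div_cancel₀ _ (show (m : ℝ) + 1 ≠ 0 by positivity), Int.fract_intCast]
  norm_num

theorem floorMap_one (n : ℕ) : floorMap n n (1 : liftGroup D) = PeriodicMap.id n := by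
  refine PeriodicMap.ext (funext fun l => ?_) rfl
  change ⌊((n : ℝ) + 1) * (l / (n + 1))⌋ = l
  rw [mul_div_cancel₀ _ (show (n : ℝ) + 1 ≠ 0 by positivity), Int.floor_intCast]

/-- Moving a translation by `k * N` turns past `a` multiplies it by the sign of `a`. The factor `z ^
k` does not notice the sign, because `z` is an involution. -/
theorem floorMap_mul_deck (m n : ℕ) (a : liftGroup D) (k : ℤ) :
    PeriodicMap.setoid m n (floorMap m n a) (floorMap m n (a * deckGenerator D ^ k)) := by
  have hz : D.z ^ ((D.χ a.1.2 : ℤ) * k) = D.z ^ k := by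
    rcases sign_cases a.1.2 with h | h
    · simp [h]
    · simp only [h, Units.val_neg, Units.val_one, neg_mul, one_mul, zpow_z_neg]
  refine ⟨(D.χ a.1.2 : ℤ) * k, ?_, fun l => ?_⟩
  · rw [hz, ← deckGenerator_zpow_snd]
    rfl
  · change ⌊((n : ℝ) + 1) * a.1.1 ((deckGenerator D ^ k).1.1 (l / (m + 1)))⌋
      = ⌊((n : ℝ) + 1) * a.1.1 (l / (m + 1))⌋ + _
    have := lift_add_int a (l / (m + 1)) (k * D.N)
    push_cast at this
    rw [deckGenerator_zpow_fst, this, ← Int.floor_add_intCast]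
    congr 1
    push_cast
    ring

/-- The morphism of the planar crossed simplicial group induced by an element of the planar
homeomorphism group. -/
def floorClass (m n : ℕ) (h : HomeoG D) : Quotient (PeriodicMap.setoid (D := D) m n) :=
  Quotient.liftOn' h (fun a => Quotient.mk _ (floorMap m n a)) (by
    intro a b hab
    obtain ⟨k, hk⟩ := QuotientGroup.leftRel_apply.1 hab
    have hb : b = a * deckGenerator D ^ k := by
      rw [eq_mul_of_inv_mul_eq hk.symm]
    rw [hb]
    exact Quotient.sound (floorMap_mul_deck m n a k))

theorem floorClass_coe (m n : ℕ) (a : liftGroup D) :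
    floorClass m n (a : HomeoG D) = Quotient.mk _ (floorMap m n a) := rfl

/-! ### Local constancy -/

theorem continuous_lift_apply (x : ℝ) : Continuous fun a : liftGroup D => a.1.1 x := by
  have h0 : Continuous fun f : ℝ ≃ₜ ℝ =>
      ((⟨f, f.continuous⟩ : C(ℝ, ℝ)), (⟨f.symm, f.symm.continuous⟩ : C(ℝ, ℝ))) :=
    continuous_induced_dom
  have h : Continuous fun f : ℝ ≃ₜ ℝ => f x :=
    (continuous_eval_const (F := C(ℝ, ℝ)) x).comp (continuous_fst.comp h0)
  exact h.comp (continuous_fst.comp continuous_subtype_val)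

/-- One period determines a periodic map, so local constancy has to be checked at finitely many
points only. -/
theorem PeriodicMap.ext_of_lt {m n : ℕ} {f g : PeriodicMap D m n} (hs : f.s = g.s)
    (h : ∀ i : Fin (m + 1), f.toFun (i : ℕ) = g.toFun (i : ℕ)) : f = g := by
  refine PeriodicMap.ext (funext fun l => ?_) hs
  have h0 : 0 ≤ l % (m + 1) := Int.emod_nonneg _ (by omega)
  have h1 : l % (m + 1) < m + 1 := Int.emod_lt_of_pos _ (by omega)
  have h2 := h ⟨(l % (m + 1)).toNat, by omega⟩
  simp only [Int.toNat_of_nonneg h0] at h2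
  rw [← Int.emod_add_mul_ediv l (m + 1), mul_comm ((m : ℤ) + 1), f.map_add_mul, g.map_add_mul, hs,
    h2]

/-- `S` is discrete, and a displacement of less than `1/2` at each of the `m + 1` left endpoints
cannot cross a gap of the marking. -/
theorem eventually_floorMap_eq {m n : ℕ} (a : liftGroup D) (ha : MapsMarking m n (a : HomeoG D)) :
    ∀ᶠ b : liftGroup D in 𝓝 a,
      MapsMarking m n (b : HomeoG D) → floorMap m n b = floorMap m n a := by
  have h1 : ∀ᶠ b : liftGroup D in 𝓝 a, b.1.2 = a.1.2 :=
    ((continuous_snd.comp continuous_subtype_val).tendsto a).eventually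
      (eventually_nhds_iff.2 ⟨{a.1.2}, fun _ h => h, isOpen_discrete _, rfl⟩)
  have h2 : ∀ᶠ b : liftGroup D in 𝓝 a, ∀ i : Fin (m + 1),
      |((n : ℝ) + 1) * b.1.1 ((((i : ℕ) : ℤ) : ℝ) / (m + 1))
        - ((n : ℝ) + 1) * a.1.1 ((((i : ℕ) : ℤ) : ℝ) / (m + 1))| < 1 / 2 := by
    rw [Filter.eventually_all]
    intro i
    have hc : Continuous fun b : liftGroup D =>
        |((n : ℝ) + 1) * b.1.1 ((((i : ℕ) : ℤ) : ℝ) / (m + 1))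
          - ((n : ℝ) + 1) * a.1.1 ((((i : ℕ) : ℤ) : ℝ) / (m + 1))| :=
      ((continuous_const.mul (continuous_lift_apply _)).sub continuous_const).abs
    exact hc.continuousAt.eventually_lt continuousAt_const (by simp)
  filter_upwards [h1, h2] with b hb1 hb2 hb
  refine PeriodicMap.ext_of_lt hb1 fun i => floor_eq_of_abs_sub_lt ?_ ?_ (hb2 i)
  all_goals
    refine mapsMarking_coe.1 (by assumption) _ ?_
    rw [mul_div_cancel₀ _ (show (m : ℝ) + 1 ≠ 0 by positivity), Int.fract_intCast]
    norm_num

theorem eventually_floorClass_eq {m n : ℕ} (h : HomeoG D) (hh : MapsMarking m n h) :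
    ∀ᶠ h' in 𝓝 h, MapsMarking m n h' → floorClass m n h' = floorClass m n h := by
  induction h using QuotientGroup.induction_on with
  | H a =>
    -- The quotient map is open, so the neighbourhoods of a class are the images of those of a lift.
    rw [← QuotientGroup.isOpenQuotientMap_mk.map_nhds_eq, Filter.eventually_map]
    filter_upwards [eventually_floorMap_eq a hh] with b hb hm
    rw [floorClass_coe, floorClass_coe, hb hm]

theorem floorClass_eq_of_path {m n : ℕ} (u : unitInterval → HomeoG D) (hu : Continuous u)
    (hm : ∀ t, MapsMarking m n (u t)) : floorClass m n (u 0) = floorClass m n (u 1) := by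
  have hloc : IsLocallyConstant fun t => floorClass m n (u t) := by
    rw [IsLocallyConstant.iff_eventually_eq]
    intro t
    filter_upwards [hu.continuousAt.eventually (eventually_floorClass_eq (u t) (hm t))] with t' ht'
    exact ht' (hm t')
  exact hloc.apply_eq_of_isPreconnected isPreconnected_univ trivial trivial

/-! ### Paths of lifts -/

/-- The straight path works: both lifts send a marked point into the same interval, which is convex,
and they have the same sign, so the quasiperiodicity survives. -/
theorem exists_path_of_floorMap_eq {m n : ℕ} {a b : liftGroup D}
    (ha : MapsMarking m n (a : HomeoG D)) (hb : MapsMarking m n (b : HomeoG D))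
    (hab : floorMap m n a = floorMap m n b) :
    ∃ u : unitInterval → liftGroup D, Continuous u ∧ u 0 = a ∧ u 1 = b ∧
      ∀ t, MapsMarking m n (u t : HomeoG D) := by
  have hs : a.1.2 = b.1.2 := congrArg PeriodicMap.s hab
  obtain ⟨v, hv, hvx⟩ : ∃ u : unitInterval → (ℝ ≃ₜ ℝ), Continuous u ∧
      ∀ t x, u t x = (1 - (t : ℝ)) * a.1.1 x + t * b.1.1 x := by
    rcases sign_cases a.1.2 with h | h
    · exact exists_homeo_lerp_of_strictMono _ _ (lift_strictMono a h)
        (lift_strictMono b (hs ▸ h))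
    · exact exists_homeo_lerp_of_strictAnti _ _ (lift_strictAnti a h)
        (lift_strictAnti b (hs ▸ h))
  have hmem : ∀ t, (v t, a.1.2) ∈ liftGroup D := fun t x => by
    simp only [hvx]
    rw [a.2, b.2, ← hs]
    ring
  refine ⟨fun t => ⟨(v t, a.1.2), hmem t⟩, (hv.prodMk continuous_const).subtype_mk _, ?_, ?_,
    fun t => mapsMarking_coe.2 fun x hx => ?_⟩
  · exact Subtype.ext (Prod.ext (Homeomorph.ext fun x => by simp [hvx]) rfl)
  · exact Subtype.ext (Prod.ext (Homeomorph.ext fun x => by simp [hvx]) hs)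
  · have ea := floor_apply_eq ha hx
    have eb := floor_apply_eq hb hx
    rw [← hab, ← ea] at eb
    have a1 := Int.floor_le (((n : ℝ) + 1) * a.1.1 x)
    have b1 := Int.floor_le (((n : ℝ) + 1) * b.1.1 x)
    have a2 := le_floor_add_half (mapsMarking_coe.1 ha x hx)
    have b2 := le_floor_add_half (mapsMarking_coe.1 hb x hx)
    rw [eb] at b1 b2
    rw [fract_le_half_iff]
    refine ⟨⌊((n : ℝ) + 1) * a.1.1 x⌋, ?_, ?_⟩
    · have h1 := mul_le_mul_of_nonneg_left a1 (sub_nonneg.2 t.2.2)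
      have h2 := mul_le_mul_of_nonneg_left b1 t.2.1
      simp only [hvx]
      linarith
    · have h1 := mul_le_mul_of_nonneg_left a2 (sub_nonneg.2 t.2.2)
      have h2 := mul_le_mul_of_nonneg_left b2 t.2.1
      simp only [hvx]
      linarith

theorem exists_lift_of_rel {m n : ℕ} {a : liftGroup D} {f : PeriodicMap D m n}
    (h : PeriodicMap.setoid m n (floorMap m n a) f) :
    ∃ b : liftGroup D, (b : HomeoG D) = a ∧ floorMap m n b = f := by
  obtain ⟨r, h1, h2⟩ := h
  have hχ : (D.χ a.1.2 : ℤ) * ((D.χ a.1.2 : ℤ) * r) = r := by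
    rw [← mul_assoc, ← Units.val_mul, ← sq, Int.units_sq]
    simp
  -- The sign in the exponent cancels the one produced by moving the translation past `a`.
  refine ⟨a * deckGenerator D ^ ((D.χ a.1.2 : ℤ) * r), ?_, ?_⟩
  · exact (QuotientGroup.mk_mul_of_mem a ⟨_, rfl⟩)
  · have h3 := deckGenerator_zpow_snd (D := D) ((D.χ a.1.2 : ℤ) * r)
    have h4 := deckGenerator_zpow_fst (D := D) ((D.χ a.1.2 : ℤ) * r)
    refine PeriodicMap.ext (funext fun l => ?_) ?_
    · change ⌊((n : ℝ) + 1) * a.1.1 ((deckGenerator D ^ ((D.χ a.1.2 : ℤ) * r)).1.1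
        (l / (m + 1)))⌋ = _
      have := lift_add_int a (l / (m + 1)) ((D.χ a.1.2 : ℤ) * r * D.N)
      have h5 : ((D.χ a.1.2 : ℤ) : ℝ) * (((D.χ a.1.2 : ℤ) : ℝ) * r) = r := by exact_mod_cast hχ
      push_cast at this
      rw [h4, h2]
      push_cast
      rw [this]
      change _ = ⌊((n : ℝ) + 1) * a.1.1 (l / (m + 1))⌋ + _
      rw [← Int.floor_add_intCast]
      congr 1
      push_cast
      rw [← mul_assoc ((D.χ a.1.2 : ℤ) : ℝ), h5]
      ring
    · change a.1.2 * (deckGenerator D ^ ((D.χ a.1.2 : ℤ) * r)).1.2 = _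
      rw [h3, h1]
      change _ = a.1.2 * _
      congr 1
      rcases sign_cases a.1.2 with h | h
      · simp [h]
      · simp only [h, Units.val_neg, Units.val_one, neg_mul, one_mul, zpow_z_neg]

theorem exists_path_of_floorClass_eq {m n : ℕ} {h h' : HomeoG D} (hh : MapsMarking m n h)
    (hh' : MapsMarking m n h') (heq : floorClass m n h = floorClass m n h') :
    ∃ u : unitInterval → HomeoG D, Continuous u ∧ u 0 = h ∧ u 1 = h' ∧
      ∀ t, MapsMarking m n (u t) := by
  induction h using QuotientGroup.induction_on with
  | H a =>
    induction h' using QuotientGroup.induction_on with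
    | H b =>
      obtain ⟨c, hc, hcb⟩ := exists_lift_of_rel (Quotient.exact heq)
      rw [← hc] at hh
      obtain ⟨u, hu, h0, h1, hm⟩ := exists_path_of_floorMap_eq hh hh' hcb
      exact ⟨fun t => u t, QuotientGroup.continuous_mk.comp hu, by simp only [h0, hc], by simp only [h1], hm⟩

/-! ### Realization of periodic maps -/

theorem exists_lift_floorMap_eq {m n : ℕ} (f : PeriodicMap D m n) :
    ∃ a : liftGroup D, MapsMarking m n (a : HomeoG D) ∧ floorMap m n a = f := by
  have hm : (m : ℝ) + 1 ≠ 0 := by positivity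
  have hn : (n : ℝ) + 1 ≠ 0 := by positivity
  obtain ⟨g, hg, hgf⟩ : ∃ g : ℝ ≃ₜ ℝ,
      (∀ y, g (y + (m + 1)) = g y + ((D.χ f.s : ℤ) : ℝ) * (n + 1)) ∧
      ∀ (l : ℤ) (y : ℝ), (l : ℝ) ≤ y → y ≤ l + 1 / 2 →
        (f.toFun l : ℝ) ≤ g y ∧ g y ≤ f.toFun l + 1 / 2 := by
    rcases sign_cases f.s with h | h
    · obtain ⟨g, h1, h2⟩ := exists_orderIso_of_monotone m n f.toFun (f.monotone h)
        (fun l => by rw [f.periodic, h]; simp)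
      exact ⟨g.toHomeomorph, fun y => by simp [h, h1], fun l y => h2 l y⟩
    · obtain ⟨g, h1, h2⟩ := exists_orderIso_of_monotone m n (fun l => -f.toFun l)
        (fun i j hij => neg_le_neg (f.antitone h hij))
        (fun l => by rw [f.periodic, h]; simp; ring)
      -- The reflection `y ↦ 1/2 - y` carries `[-k, -k + 1/2]` onto `[k, k + 1/2]`, so it undoes the
      -- negation and respects the marking.
      refine ⟨g.toHomeomorph.trans (Homeomorph.subLeft (1 / 2)), fun y => ?_,
        fun l y hl hy => ?_⟩
      · simp [h, h1]
        ring
      · have := h2 l y hl hy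
        simp only [Homeomorph.trans_apply, OrderIso.coe_toHomeomorph, Homeomorph.coe_subLeft]
        push_cast at this
        constructor <;> linarith [this.1, this.2]
  let φ : ℝ ≃ₜ ℝ := ((Homeomorph.mulLeft₀ _ hm).trans g).trans
    (Homeomorph.mulLeft₀ _ (inv_ne_zero hn))
  have hφ : ∀ x, φ x = ((n : ℝ) + 1)⁻¹ * g ((m + 1) * x) := fun x => rfl
  have hφ' : ∀ x, ((n : ℝ) + 1) * φ x = g ((m + 1) * x) := fun x => by
    rw [hφ, mul_inv_cancel_left₀ hn]
  refine ⟨⟨(φ, f.s), fun x => ?_⟩, mapsMarking_coe.2 fun x hx => ?_,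
    PeriodicMap.ext (funext fun l => ?_) rfl⟩
  · simp only [hφ]
    rw [mul_add, mul_one, hg]
    field_simp
  · simp only [hφ']
    obtain ⟨k, h1, h2⟩ := (fract_le_half_iff _).1 hx
    exact (fract_le_half_iff _).2 ⟨_, hgf k _ h1 h2⟩
  · change ⌊((n : ℝ) + 1) * φ (l / (m + 1))⌋ = _
    rw [hφ', mul_div_cancel₀ _ hm, Int.floor_eq_iff]
    obtain ⟨h1, h2⟩ := hgf l l le_rfl (by linarith)
    exact ⟨h1, by linarith⟩

/-! ### Markings of the circle -/

/-- The one-dimensional Borsuk–Ulam argument: `f y - f (y + 1/2)` changes sign over half a turn, so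
two antipodal points have the same value. -/
theorem not_injective_of_continuous_circle {f : S1 → ℝ} (hf : Continuous f) :
    ¬ Function.Injective f := by
  intro hinj
  let h : ℝ → ℝ := fun y => f (y : S1) - f ((y + 1 / 2 : ℝ) : S1)
  have hh : Continuous h := (hf.comp (AddCircle.continuous_mk' 1)).sub
    (hf.comp ((AddCircle.continuous_mk' 1).comp (continuous_id.add continuous_const)))
  have hneg : h (1 / 2) = -h 0 := by
    have h1 : ((1 / 2 + 1 / 2 : ℝ) : S1) = ((0 : ℝ) : S1) :=
      coe_eq_coe_iff_exists_int.2 ⟨1, by norm_num⟩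
    simp only [h, h1, zero_add]
    ring
  obtain ⟨y, hy⟩ : (0 : ℝ) ∈ Set.range h := by
    rcases le_total (h 0) 0 with h0 | h0
    · exact mem_range_of_exists_le_of_exists_ge hh ⟨0, h0⟩ ⟨1 / 2, by linarith⟩
    · exact mem_range_of_exists_le_of_exists_ge hh ⟨1 / 2, by linarith⟩ ⟨0, h0⟩
  obtain ⟨k, hk⟩ := coe_eq_coe_iff_exists_int.1 (hinj (sub_eq_zero.1 hy))
  have h2 : (2 * k : ℤ) = (-1 : ℤ) := by
    have : (2 * k : ℝ) = -1 := by linarith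
    exact_mod_cast this
  omega

/-- If `J` were the whole circle, connectedness would leave a single interval, whose coordinate
would be a continuous injection of the circle into `ℝ`. -/
theorem exists_coe_notMem {k : ℕ} {J : Set S1} (e : J ≃ₜ Fin k × unitInterval) :
    ∃ p : ℝ, (p : S1) ∉ J := by
  by_contra! hall
  have hJ : ∀ x, x ∈ J := fun x => by
    induction x using QuotientAddGroup.induction_on with
    | H y => exact hall y
  have hg : Continuous fun x : S1 => e ⟨x, hJ x⟩ :=
    e.continuous.comp (continuous_id.subtype_mk _)
  refine not_injective_of_continuous_circle (f := fun x => ((e ⟨x, hJ x⟩).2 : ℝ))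
    (continuous_subtype_val.comp (continuous_snd.comp hg)) fun x y hxy => ?_
  have h1 : (e ⟨x, hJ x⟩).1 = (e ⟨y, hJ y⟩).1 :=
    PreconnectedSpace.constant (Y := Fin k) inferInstance (continuous_fst.comp hg)
  exact congrArg Subtype.val (e.injective (Prod.ext h1 (Subtype.ext hxy)))

/-- Finitely many disjoint intervals, in increasing order. -/
theorem exists_sorted_intervals {k : ℕ} (a b : Fin k → ℝ) (hab : ∀ i, a i ≤ b i)
    (hdisj : ∀ i j, i ≠ j → Disjoint (Set.Icc (a i) (b i)) (Set.Icc (a j) (b j))) :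
    ∃ σ : Equiv.Perm (Fin k), ∀ i j, i < j → b (σ i) < a (σ j) := by
  refine ⟨Tuple.sort a, fun i j hij => ?_⟩
  have h1 : a (Tuple.sort a i) ≤ a (Tuple.sort a j) := Tuple.monotone_sort a hij.le
  by_contra! h2
  exact Set.disjoint_left.1 (hdisj _ _ ((Tuple.sort a).injective.ne hij.ne)) ⟨h1, h2⟩
    ⟨le_rfl, hab _⟩

/-- A subset of the circle that is homeomorphic to a disjoint union of intervals is, in the
complement of one of its points, the union of the images of disjoint compact intervals. -/
theorem exists_intervals {k : ℕ} {J : Set S1} (e : J ≃ₜ Fin k × unitInterval) :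
    ∃ (p : ℝ) (a b : Fin k → ℝ), (∀ i, a i < b i) ∧ (∀ i j, i < j → b i < a j) ∧
      (∀ i, p < a i ∧ b i < p + 1) ∧
      ∀ y ∈ Set.Ico p (p + 1), (y : S1) ∈ J ↔ ∃ i, y ∈ Set.Icc (a i) (b i) := by
  obtain ⟨p, hp⟩ := exists_coe_notMem e
  -- Cutting the circle at `p` gives a section of `ℝ → ℝ / ℤ` that is continuous away from `p`, in
  -- particular on `J`.
  let r : S1 → ℝ := fun x => AddCircle.equivIco 1 p x
  have hr : ∀ x, ((r x : ℝ) : S1) = x := fun x => (AddCircle.equivIco 1 p).symm_apply_apply x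
  have hrmem : ∀ x, r x ∈ Set.Ico p (p + 1) := fun x => (AddCircle.equivIco 1 p x).2
  have hrcoe : ∀ y ∈ Set.Ico p (p + 1), r (y : S1) = y := fun y hy =>
    congrArg Subtype.val ((AddCircle.equivIco 1 p).apply_symm_apply ⟨y, hy⟩)
  let δ : Fin k → unitInterval → ℝ := fun i t => r (e.symm (i, t))
  have hδ : ∀ i, Continuous (δ i) := by
    intro i
    rw [continuous_iff_continuousAt]
    intro t
    have h1 : ContinuousAt r (e.symm (i, t) : S1) :=
      continuous_subtype_val.continuousAt.comp (AddCircle.continuousAt_equivIco 1 p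
        (fun h => hp (h ▸ (e.symm (i, t)).2)))
    exact ContinuousAt.comp (f := fun t => (e.symm (i, t) : S1)) h1
      (continuous_subtype_val.comp (e.symm.continuous.comp
        (continuous_const.prodMk continuous_id))).continuousAt
  have hinj : ∀ i j s t, δ i s = δ j t → i = j ∧ s = t := by
    intro i j s t h
    have h1 : (e.symm (i, s) : S1) = e.symm (j, t) := by
      rw [← hr (e.symm (i, s)), ← hr (e.symm (j, t))]
      exact congrArg _ h
    exact Prod.ext_iff.1 (e.symm.injective (Subtype.ext h1))
  have hIcc : ∀ i, ∃ a b : ℝ, a ≤ b ∧ Set.range (δ i) = Set.Icc a b := by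
    intro i
    have h1 := eq_Icc_of_connected_compact (isConnected_range (hδ i)) (isCompact_range (hδ i))
    refine ⟨_, _, ?_, h1⟩
    rw [← Set.nonempty_Icc, ← h1]
    exact Set.range_nonempty _
  choose a b hab hrange using hIcc
  have hlt : ∀ i, a i < b i := by
    intro i
    refine (hab i).lt_of_ne fun h => ?_
    have h0 : δ i 0 ∈ Set.Icc (a i) (b i) := hrange i ▸ ⟨0, rfl⟩
    have h1 : δ i 1 ∈ Set.Icc (a i) (b i) := hrange i ▸ ⟨1, rfl⟩
    rw [← h, Set.Icc_self] at h0 h1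
    exact zero_ne_one (hinj i i 0 1 (h0.trans h1.symm)).2
  have hdisj : ∀ i j, i ≠ j → Disjoint (Set.Icc (a i) (b i)) (Set.Icc (a j) (b j)) := by
    intro i j hij
    rw [← hrange, ← hrange, Set.disjoint_left]
    rintro _ ⟨s, rfl⟩ ⟨t, ht⟩
    exact hij (hinj _ _ _ _ ht).1.symm
  have hsub : ∀ i, ∀ y ∈ Set.Icc (a i) (b i), p < y ∧ y < p + 1 ∧ (y : S1) ∈ J := by
    intro i y hy
    rw [← hrange] at hy
    obtain ⟨t, rfl⟩ := hy
    have h1 : ((δ i t : ℝ) : S1) ∈ J := by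
      simp only [δ, hr]
      exact (e.symm (i, t)).2
    refine ⟨(hrmem _).1.lt_of_ne fun h => hp ?_, (hrmem _).2, h1⟩
    rw [h]
    exact h1
  obtain ⟨σ, hσ⟩ := exists_sorted_intervals a b hab hdisj
  refine ⟨p, a ∘ σ, b ∘ σ, fun i => hlt _, hσ, fun i => ⟨(hsub _ _ ⟨le_rfl, hab _⟩).1,
    (hsub _ _ ⟨hab _, le_rfl⟩).2.1⟩, fun y hy => ⟨fun h => ?_, fun ⟨i, hi⟩ => (hsub _ _ hi).2.2⟩⟩
  refine ⟨σ.symm (e ⟨y, h⟩).1, ?_⟩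
  simp only [Function.comp_apply, Equiv.apply_symm_apply]
  rw [← hrange]
  refine ⟨(e ⟨y, h⟩).2, ?_⟩
  simp only [δ, Prod.mk.eta, Homeomorph.symm_apply_apply]
  exact hrcoe y hy

theorem exists_interleaving (A B : ℤ → ℝ) (h1 : ∀ l, A l < B l) (h2 : ∀ l, B l < A (l + 1)) :
    ∃ c : ℤ → ℝ, StrictMono c ∧ ∀ l, c (2 * l) = A l ∧ c (2 * l + 1) = B l := by
  let c : ℤ → ℝ := fun j => if j % 2 = 0 then A (j / 2) else B (j / 2)
  have hc : ∀ l, c (2 * l) = A l ∧ c (2 * l + 1) = B l := by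
    intro l
    simp only [c]
    rw [if_pos (by omega), if_neg (by omega), show 2 * l / 2 = l by omega,
      show (2 * l + 1) / 2 = l by omega]
    exact ⟨rfl, rfl⟩
  refine ⟨c, strictMono_int_of_lt_succ fun j => ?_, hc⟩
  obtain ⟨l, rfl | rfl⟩ : ∃ l, j = 2 * l ∨ j = 2 * l + 1 := ⟨j / 2, by omega⟩
  · rw [(hc l).1, (hc l).2]
    exact h1 l
  · rw [show 2 * l + 1 + 1 = 2 * (l + 1) by ring, (hc l).2, (hc (l + 1)).1]
    exact h2 l

/-- The preimage in the line of a marking of the circle with `n + 1` components. -/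
theorem exists_endpoints {n : ℕ} {J : Set S1} (e : J ≃ₜ Fin (n + 1) × unitInterval) :
    ∃ c : ℤ → ℝ, StrictMono c ∧ (∀ j, c (j + (2 * (n + 1) : ℕ)) = c j + 1) ∧
      ∀ y : ℝ, (y : S1) ∈ J ↔ ∃ l : ℤ, c (2 * l) ≤ y ∧ y ≤ c (2 * l + 1) := by
  obtain ⟨p, a, b, hab, hlt, hp, hJ⟩ := exists_intervals e
  have hn : (0 : ℤ) < n + 1 := by omega
  -- The lifted intervals are numbered by `l = i + q * (n + 1)`, where `i` is the component and `q`
  -- the turn.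
  let ι : ℤ → Fin (n + 1) := fun l => ⟨(l % (n + 1)).toNat, by
    have := Int.emod_nonneg l hn.ne'
    have := Int.emod_lt_of_pos l hn
    omega⟩
  have hι : ∀ (i : Fin (n + 1)) (q : ℤ), ι (i + q * (n + 1)) = i := fun i q => by
    refine Fin.ext ?_
    simp only [ι, Int.add_mul_emod_self_right]
    rw [Int.emod_eq_of_lt (by omega) (by omega)]
    simp
  have hdiv : ∀ (i : Fin (n + 1)) (q : ℤ), ((i : ℤ) + q * (n + 1)) / (n + 1) = q := fun i q => by
    rw [Int.add_mul_ediv_right _ _ hn.ne', Int.ediv_eq_zero_of_lt (by omega) (by omega), zero_add]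
  have hcases : ∀ l : ℤ, ∃ (i : Fin (n + 1)) (q : ℤ), l = i + q * (n + 1) := fun l => by
    refine ⟨ι l, l / (n + 1), ?_⟩
    simp only [ι]
    rw [Int.toNat_of_nonneg (Int.emod_nonneg l hn.ne'), mul_comm, Int.emod_add_mul_ediv]
  let A : ℤ → ℝ := fun l => a (ι l) + (l / (n + 1) : ℤ)
  let B : ℤ → ℝ := fun l => b (ι l) + (l / (n + 1) : ℤ)
  have hA : ∀ (i : Fin (n + 1)) (q : ℤ), A (i + q * (n + 1)) = a i + q := fun i q => by
    simp only [A, hι, hdiv]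
  have hB : ∀ (i : Fin (n + 1)) (q : ℤ), B (i + q * (n + 1)) = b i + q := fun i q => by
    simp only [B, hι, hdiv]
  have hBA : ∀ l, B l < A (l + 1) := by
    intro l
    obtain ⟨i, q, rfl⟩ := hcases l
    rw [hB]
    by_cases hi : (i : ℕ) < n
    · rw [show (i : ℤ) + q * (n + 1) + 1
          = ((⟨i + 1, by omega⟩ : Fin (n + 1)) : ℕ) + q * (n + 1) by push_cast; ring, hA]
      have := hlt i ⟨i + 1, by omega⟩ (Fin.lt_def.2 (Nat.lt_succ_self _))
      linarith
    · have hi' : (i : ℤ) = n := by omega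
      rw [show (i : ℤ) + q * (n + 1) + 1
          = ((0 : Fin (n + 1)) : ℕ) + (q + 1) * (n + 1) by rw [hi', Fin.val_zero]; push_cast; ring, hA]
      have h1 := (hp i).2
      have h2 := (hp 0).1
      push_cast
      linarith
  have hAB : ∀ l, A l < B l := fun l => by
    have := hab (ι l)
    simp only [A, B]
    linarith
  obtain ⟨c, hc, hcAB⟩ := exists_interleaving A B hAB hBA
  refine ⟨c, hc, fun j => ?_, fun y => ?_⟩
  · obtain ⟨l, hl⟩ : ∃ l, j = 2 * l ∨ j = 2 * l + 1 := ⟨j / 2, by omega⟩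
    obtain ⟨i, q, rfl⟩ := hcases l
    have hs : (i : ℤ) + q * (n + 1) + (n + 1) = i + (q + 1) * (n + 1) := by ring
    rcases hl with rfl | rfl
    · rw [show 2 * ((i : ℤ) + q * (n + 1)) + (2 * (n + 1) : ℕ)
        = 2 * (i + (q + 1) * (n + 1)) by push_cast; ring, (hcAB _).1, (hcAB _).1, hA, hA]
      push_cast
      ring
    · rw [show 2 * ((i : ℤ) + q * (n + 1)) + 1 + (2 * (n + 1) : ℕ)
        = 2 * (i + (q + 1) * (n + 1)) + 1 by push_cast; ring, (hcAB _).2, (hcAB _).2, hB, hB]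
      push_cast
      ring
  · simp only [hcAB]
    have hfl := Int.floor_le (y - p)
    have hfl' := Int.lt_floor_add_one (y - p)
    have hy : (y : S1) = ((y - ⌊y - p⌋ : ℝ) : S1) :=
      coe_eq_coe_iff_exists_int.2 ⟨⌊y - p⌋, by ring⟩
    rw [hy, hJ _ ⟨by linarith, by linarith⟩]
    constructor
    · rintro ⟨i, h1, h2⟩
      refine ⟨i + ⌊y - p⌋ * (n + 1), ?_, ?_⟩
      · rw [hA]
        linarith
      · rw [hB]
        linarith
    · rintro ⟨l, h1, h2⟩
      obtain ⟨i, q, rfl⟩ := hcases l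
      rw [hA] at h1
      rw [hB] at h2
      have hq : ⌊y - p⌋ = q := by
        rw [Int.floor_eq_iff]
        constructor <;> linarith [(hp i).1, (hp i).2]
      refine ⟨i, ?_, ?_⟩ <;> rw [hq] <;> linarith

/-! ### The standard marking and its complement -/

theorem stdMarking_homeomorph (n : ℕ) :
    Nonempty (stdMarking n ≃ₜ Fin (n + 1) × unitInterval) := by
  have hn : (0 : ℝ) < n + 1 := by positivity
  let f : Fin (n + 1) × unitInterval → S1 := fun x =>
    (((((x.1 : ℕ) : ℝ) + x.2 / 2) / (n + 1) : ℝ) : S1)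
  have hf : Continuous f := by
    refine (AddCircle.continuous_mk' 1).comp (Continuous.div_const ?_ _)
    refine Continuous.add ?_ ((continuous_subtype_val.comp continuous_snd).div_const 2)
    exact (continuous_of_discreteTopology (f := fun i : Fin (n + 1) => ((i : ℕ) : ℝ))).comp
      continuous_fst
  have hinj : Function.Injective f := by
    rintro ⟨i, s⟩ ⟨j, t⟩ h
    obtain ⟨k, hk⟩ := coe_eq_coe_iff_exists_int.1 h
    have hk' : ((i : ℕ) : ℝ) + s / 2 = ((j : ℕ) : ℝ) + t / 2 + k * (n + 1) := by
      field_simp at hk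
      linarith
    have hs : ⌊((i : ℕ) : ℝ) + s / 2⌋ = (i : ℕ) := by
      rw [Int.floor_eq_iff]
      push_cast
      constructor <;> linarith [s.2.1, s.2.2]
    have ht : ⌊((j : ℕ) : ℝ) + t / 2 + k * (n + 1)⌋ = (j : ℕ) + k * (n + 1) := by
      rw [Int.floor_eq_iff]
      push_cast
      constructor <;> linarith [t.2.1, t.2.2]
    rw [hk', ht] at hs
    have hi := i.2
    have hj := j.2
    -- Comparing floors gives `i = j + k * (n + 1)` with both indices in `[0, n]`.
    have hk0 : k = 0 := by
      by_contra hne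
      rcases lt_or_gt_of_ne hne with h | h
      · nlinarith
      · nlinarith
    rw [hk0] at hs hk'
    have hij : i = j := Fin.ext (by omega)
    subst hij
    refine Prod.ext rfl (Subtype.ext ?_)
    simp only [Int.cast_zero, zero_mul, add_zero] at hk'
    linarith
  have hrange : Set.range f = stdMarking n := by
    ext x
    constructor
    · rintro ⟨⟨i, t⟩, rfl⟩
      refine coe_mem_stdMarking.2 ?_
      rw [mul_div_cancel₀ _ hn.ne', fract_le_half_iff]
      refine ⟨(i : ℕ), ?_, ?_⟩ <;> push_cast <;> linarith [t.2.1, t.2.2]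
    · rintro ⟨y, rfl, hy⟩
      obtain ⟨k, h1, h2⟩ := (fract_le_half_iff _).1 hy
      have hn' : (0 : ℤ) < n + 1 := by omega
      have hmod := Int.emod_nonneg k hn'.ne'
      have hlt := Int.emod_lt_of_pos k hn'
      refine ⟨(⟨(k % (n + 1)).toNat, by omega⟩,
        ⟨2 * ((n + 1) * y - k), by linarith, by linarith⟩),
        coe_eq_coe_iff_exists_int.2 ⟨-(k / (n + 1)), ?_⟩⟩
      have h3 : (((k % (n + 1)).toNat : ℕ) : ℝ) = k - (n + 1) * (k / (n + 1) : ℤ) := by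
        have h4 : (((k % (n + 1)).toNat : ℕ) : ℤ) = k - (n + 1) * (k / (n + 1)) := by
          rw [Int.toNat_of_nonneg hmod]
          linarith [Int.emod_add_mul_ediv k (n + 1)]
        exact_mod_cast congrArg (Int.cast (R := ℝ)) h4
      simp only [h3]
      push_cast
      field_simp
      ring
  have hemb : IsEmbedding f := (hf.isClosedEmbedding hinj).isEmbedding
  exact ⟨((Homeomorph.setCongr hrange).symm.trans hemb.toHomeomorph.symm)⟩

theorem isMarking_of_homeomorph {C : Type*} [TopologicalSpace C] [T2Space C] {J : Set C} {n : ℕ}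
    (e : J ≃ₜ Fin (n + 1) × unitInterval) : IsMarking J := by
  have : CompactSpace J := e.symm.compactSpace
  exact ⟨(isCompact_iff_compactSpace.2 this).isClosed, ⟨_, (e.symm (0, 0)).2⟩, n + 1, ⟨e⟩⟩

theorem IsMarking.exists_homeomorph {C : Type*} [TopologicalSpace C] {J : Set C}
    (h : IsMarking J) : ∃ n : ℕ, Nonempty (J ≃ₜ Fin (n + 1) × unitInterval) := by
  obtain ⟨-, ⟨x, hx⟩, k, ⟨e⟩⟩ := h
  cases k with
  | zero => exact (e ⟨x, hx⟩).1.elim0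
  | succ n => exact ⟨n, ⟨e⟩⟩

/-- The rotation of the circle that interchanges the standard marking with its interstices. -/
def halfTurn (n : ℕ) : S1 ≃ₜ S1 := Homeomorph.addRight (((1 / (2 * (n + 1)) : ℝ)) : S1)

theorem halfTurn_coe (n : ℕ) (y : ℝ) :
    halfTurn n (y : S1) = ((y + 1 / (2 * (n + 1)) : ℝ) : S1) := rfl

/-- In the coordinate `(n + 1) * y` the interstices are the open intervals from `k - 1/2` to `k`;
their closures are the marked intervals shifted by `1/2`. -/
theorem closure_compl_stdMarking (n : ℕ) :
    closure (stdMarking n)ᶜ = halfTurn n ⁻¹' stdMarking n := by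
  have hn : (0 : ℝ) < n + 1 := by positivity
  have hhalf : ∀ y : ℝ, ((n : ℝ) + 1) * (y + 1 / (2 * (n + 1))) = (n + 1) * y + 1 / 2 :=
    fun y => by field_simp
  obtain ⟨e⟩ := stdMarking_homeomorph n
  refine Set.Subset.antisymm (closure_minimal ?_
    ((isMarking_of_homeomorph e).1.preimage (halfTurn n).continuous)) ?_
  · intro x hx
    induction x using QuotientAddGroup.induction_on with
    | H y =>
      have h1 : ¬ Int.fract ((n + 1) * y) ≤ 1 / 2 := fun h => hx (coe_mem_stdMarking.2 h)
      change halfTurn n (y : S1) ∈ stdMarking n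
      rw [halfTurn_coe, coe_mem_stdMarking, hhalf, fract_le_half_iff]
      have h2 := Int.floor_add_fract ((n + 1) * y)
      have h3 := Int.fract_lt_one ((n + 1) * y)
      refine ⟨⌊(n + 1) * y⌋ + 1, ?_, ?_⟩ <;> push_cast <;> linarith
  · intro x hx
    induction x using QuotientAddGroup.induction_on with
    | H y =>
      change halfTurn n (y : S1) ∈ stdMarking n at hx
      rw [halfTurn_coe, coe_mem_stdMarking, hhalf, fract_le_half_iff] at hx
      obtain ⟨k, h1, h2⟩ := hx
      let u : ℝ → S1 := fun t => ((t / (n + 1) : ℝ) : S1)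
      have hu : Continuous u := (AddCircle.continuous_mk' 1).comp (continuous_id.div_const _)
      have hmaps : Set.MapsTo u (Set.Ioo ((k : ℝ) - 1 / 2) k) (stdMarking n)ᶜ := by
        rintro t ⟨h3, h4⟩ h5
        rw [coe_mem_stdMarking, mul_div_cancel₀ _ hn.ne', fract_le_half_iff] at h5
        obtain ⟨l, h6, h7⟩ := h5
        have h8 : l < k := by exact_mod_cast h6.trans_lt h4
        have h9 : k - 1 < l := by
          have : (k : ℝ) - 1 < l := by linarith
          exact_mod_cast this
        omega
      have hcl := hmaps.closure hu
      rw [closure_Ioo (by linarith)] at hcl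
      have h3 : u ((n + 1) * y) ∈ closure (stdMarking n)ᶜ :=
        hcl ⟨by linarith, by linarith⟩
      simpa only [u, mul_div_cancel_left₀ _ hn.ne'] using h3

/-- Two such rotations add up to `1 / (n + 1)` of a turn, a symmetry of the marking. -/
theorem halfTurn_preimage_preimage (n : ℕ) :
    halfTurn n ⁻¹' (halfTurn n ⁻¹' stdMarking n) = stdMarking n := by
  ext x
  induction x using QuotientAddGroup.induction_on with
  | H y =>
    change halfTurn n (halfTurn n (y : S1)) ∈ stdMarking n ↔ (y : S1) ∈ stdMarking n
    rw [halfTurn_coe, halfTurn_coe, coe_mem_stdMarking, coe_mem_stdMarking,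
      show ((n : ℝ) + 1) * (y + 1 / (2 * (n + 1)) + 1 / (2 * (n + 1))) = (n + 1) * y + 1 by
        field_simp
        ring, Int.fract_add_one]

theorem closure_compl_closure_compl_stdMarking (n : ℕ) :
    closure (closure (stdMarking n)ᶜ)ᶜ = stdMarking n := by
  rw [closure_compl_stdMarking, ← Set.preimage_compl, ← Homeomorph.preimage_closure,
    closure_compl_stdMarking, halfTurn_preimage_preimage]

/-! ### Standard marked circles -/

/-- The standard structured marked circle with `n + 1` marked intervals. -/
def stdCircle (D : PlanarDatum) (n : ℕ) : MarkedCircle D where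
  C := S1
  isCircle := ⟨Homeomorph.refl _⟩
  F := HomeoG D
  nonempty := ⟨1⟩
  torsor f := (Homeomorph.mulLeft f).isHomeomorph
  ρ := toHomeo D
  ρ_smul h f := map_mul (toHomeo D) f h
  J := stdMarking n
  marking := isMarking_of_homeomorph (stdMarking_homeomorph n).some

/-- An arbitrary frame is corrected by a homeomorphism that moves the equally spaced endpoints `j /
(2 * (n + 1))` to the endpoints `c j` of `J`. It preserves the orientation and takes the element `1`
of `S`, so it exists for every planar type. -/
theorem exists_frame (X : MarkedCircle D) {n : ℕ} (e : X.J ≃ₜ Fin (n + 1) × unitInterval) :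
    ∃ f : X.F, X.ρ f ⁻¹' X.J = stdMarking n := by
  obtain ⟨f⟩ := X.nonempty
  obtain ⟨c, hc, hper, hJ⟩ := exists_endpoints (((X.ρ f).sets (s := X.ρ f ⁻¹' X.J) rfl).trans e)
  obtain ⟨g, hg, hgper⟩ := exists_orderIso_interpolating c hc (2 * (n + 1)) (by positivity) 1 hper
  have hn : (2 : ℝ) * (n + 1) ≠ 0 := by positivity
  let a : liftGroup D := ⟨((Homeomorph.mulLeft₀ _ hn).trans g.toHomeomorph, 1), fun x => by
    have := hgper (2 * (n + 1) * x)
    push_cast at this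
    change g (2 * (n + 1) * (x + 1)) = g (2 * (n + 1) * x) + ((D.χ 1 : ℤ) : ℝ)
    rw [map_one, mul_add, mul_one, this]
    simp⟩
  have ha : ∀ x, a.1.1 x = g (2 * (n + 1) * x) := fun x => rfl
  refine ⟨MulOpposite.op (a : HomeoG D) • f, ?_⟩
  ext x
  induction x using QuotientAddGroup.induction_on with
  | H y =>
    rw [X.ρ_smul]
    change ((a.1.1 y : ℝ) : S1) ∈ X.ρ f ⁻¹' X.J ↔ (y : S1) ∈ stdMarking n
    rw [hJ, coe_mem_stdMarking, fract_le_half_iff]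
    refine exists_congr fun l => ?_
    rw [← hg, ← hg, ha, g.le_iff_le, g.le_iff_le]
    push_cast
    constructor <;> rintro ⟨h1, h2⟩ <;> constructor <;> linarith

/-! ### Interstices of an arbitrary marking -/

theorem closure_compl_homeomorph (X : MarkedCircle D) {n : ℕ}
    (e : X.J ≃ₜ Fin (n + 1) × unitInterval) :
    Nonempty ((closure X.Jᶜ : Set X.C) ≃ₜ Fin (n + 1) × unitInterval) := by
  obtain ⟨f, hf⟩ := exists_frame X e
  obtain ⟨e'⟩ := stdMarking_homeomorph n
  have h : X.ρ f ⁻¹' (closure X.Jᶜ) = halfTurn n ⁻¹' stdMarking n := by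
    rw [Homeomorph.preimage_closure, Set.preimage_compl, hf, closure_compl_stdMarking]
  exact ⟨((X.ρ f).sets h.symm).symm.trans (((halfTurn n).sets rfl).trans e')⟩

/-- Markings are regular closed sets. This makes the duality invertible, and a frame reduces it to
the standard marking. -/
theorem closure_compl_closure_compl (X : MarkedCircle D) : closure (closure X.Jᶜ)ᶜ = X.J := by
  obtain ⟨n, ⟨e⟩⟩ := X.marking.exists_homeomorph
  obtain ⟨f, hf⟩ := exists_frame X e
  refine (X.ρ f).surjective.preimage_injective ?_
  rw [Homeomorph.preimage_closure, Set.preimage_compl, Homeomorph.preimage_closure,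
    Set.preimage_compl, hf, closure_compl_closure_compl_stdMarking]

theorem isMarking_closure_compl (X : MarkedCircle D) : IsMarking (closure X.Jᶜ) := by
  have : T2Space X.C := X.isCircle.some.symm.isEmbedding.t2Space
  obtain ⟨n, ⟨e⟩⟩ := X.marking.exists_homeomorph
  exact isMarking_of_homeomorph (closure_compl_homeomorph X e).some

/-- An isomorphism of structured circles that identifies the markings. -/
def isoOfMapsTo {X Y : MarkedCircle D} (a : MarkedHomeo X Y)
    (h : Set.MapsTo a.φ.symm Y.J X.J) : X ≅ Y where
  hom := ZerothHomotopy.mk a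
  inv := ZerothHomotopy.mk
    { φ := a.φ.symm
      φt := a.φt.symm
      equivariant := a.symm_equivariant
      comm := a.symm_comm
      maps := h }
  hom_inv_id := congrArg ZerothHomotopy.mk (MarkedHomeo.ext
    (Homeomorph.ext fun x => a.φ.symm_apply_apply x)
    (Homeomorph.ext fun x => a.φt.symm_apply_apply x))
  inv_hom_id := congrArg ZerothHomotopy.mk (MarkedHomeo.ext
    (Homeomorph.ext fun x => a.φ.apply_symm_apply x)
    (Homeomorph.ext fun x => a.φt.apply_symm_apply x))

/-- A frame `f` trivializes the torsor by `h ↦ f · h`, and `ρ f` is the underlying homeomorphism of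
circles. -/
theorem stdCircle_iso (X : MarkedCircle D) {n : ℕ} (e : X.J ≃ₜ Fin (n + 1) × unitInterval) :
    Nonempty (stdCircle D n ≅ X) := by
  obtain ⟨f, hf⟩ := exists_frame X e
  refine ⟨isoOfMapsTo (X := stdCircle D n)
    { φ := X.ρ f
      φt := (X.torsor f).homeomorph
      equivariant := fun h (k : HomeoG D) => mul_smul (MulOpposite.op h) (MulOpposite.op k) f
      comm := fun h => X.ρ_smul h f
      maps := fun x hx => ?_ } fun x hx => ?_⟩
  · exact hf.ge hx
  · refine hf.le (?_ : X.ρ f ((X.ρ f).symm x) ∈ X.J)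
    rwa [Homeomorph.apply_symm_apply]

/-! ### The interstice duality is an equivalence -/

/-- The inverse of `MarkedHomeo.dual`. -/
def MarkedHomeo.undual {X Y : MarkedCircle D} (hX : IsMarking (closure X.Jᶜ))
    (hY : IsMarking (closure Y.Jᶜ)) (a : MarkedHomeo (Y.dual hY) (X.dual hX)) :
    MarkedHomeo X Y where
  φ := a.φ.symm
  φt := a.φt.symm
  equivariant := a.symm_equivariant
  comm := a.symm_comm
  maps _ hx := (closure_compl_closure_compl Y).le
    (a.symm_maps ((closure_compl_closure_compl X).ge hx))

theorem MarkedHomeo.continuous_undual {X Y : MarkedCircle D} (hX : IsMarking (closure X.Jᶜ))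
    (hY : IsMarking (closure Y.Jᶜ)) :
    Continuous (MarkedHomeo.undual (X := X) (Y := Y) hX hY) :=
  MarkedHomeo.continuous_iff.2 fun f =>
    MarkedHomeo.continuous_symm (X := Y.dual hY) (Y := X.dual hX) f

/-- The canonical isomorphism from a marked circle to its double dual. -/
def doubleDualIso (X : MarkedCircle D) (h : IsMarking (closure X.Jᶜ))
    (h' : IsMarking (closure (X.dual h).Jᶜ)) : (X.dual h).dual h' ≅ X :=
  isoOfMapsTo
    { φ := Homeomorph.refl _
      φt := Homeomorph.refl _
      equivariant := fun _ _ => rfl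
      comm := fun _ => rfl
      maps := (closure_compl_closure_compl X).le }
    (closure_compl_closure_compl X).ge

theorem interstice_isEquivalence (h : ∀ X : MarkedCircle D, IsMarking (closure X.Jᶜ)) :
    (interstice h).IsEquivalence where
  faithful := ⟨fun {X Y} a b hab => by
    induction a using Quotient.inductionOn with
    | _ a =>
      induction b using Quotient.inductionOn with
      | _ b =>
        have h1 : Joined (a.dual (h X) (h Y)) (b.dual (h X) (h Y)) :=
          Quotient.exact (congrArg Quiver.Hom.unop hab)
        exact Quotient.sound (h1.map (MarkedHomeo.continuous_undual (h X) (h Y)))⟩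
  full := ⟨fun {X Y} a => by
    obtain ⟨b, hb⟩ : ∃ b : MarkedHomeo (Y.dual (h Y)) (X.dual (h X)),
        ZerothHomotopy.mk b = a.unop := Quotient.exists_rep a.unop
    -- Inverting twice returns `b` definitionally, so `hb` closes the goal.
    exact ⟨ZerothHomotopy.mk (b.undual (h X) (h Y)), Quiver.Hom.unop_inj hb⟩⟩
  essSurj := ⟨fun X => ⟨X.unop.dual (h _), ⟨(doubleDualIso X.unop (h _) (h _)).symm.op⟩⟩⟩

/-! ### Marked circles and the planar crossed simplicial group -/

/-- The morphism of standard marked circles given by an element of the planar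
homeomorphism group. -/
def MapsMarking.homeo {m n : ℕ} {h : HomeoG D} (hh : MapsMarking m n h) :
    MarkedHomeo (stdCircle D m) (stdCircle D n) where
  φ := toHomeo D h
  φt := (Homeomorph.mulLeft h : HomeoG D ≃ₜ HomeoG D)
  equivariant k f := (mul_assoc h (f : HomeoG D) k).symm
  comm f := map_mul (toHomeo D) h f
  maps := hh

/-- The element of the planar homeomorphism group that describes a morphism of standard circles. -/
def MarkedHomeo.toHomeoG {m n : ℕ} (a : MarkedHomeo (stdCircle D m) (stdCircle D n)) : HomeoG D :=
  a.φt (1 : HomeoG D)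

/-- The torsor is the group itself, and a map that commutes with right multiplications is a left
multiplication. -/
theorem MarkedHomeo.φt_apply {m n : ℕ} (a : MarkedHomeo (stdCircle D m) (stdCircle D n))
    (f : HomeoG D) : a.φt f = a.toHomeoG * f := by
  have h := a.equivariant f (1 : HomeoG D)
  change a.φt ((1 : HomeoG D) * f) = a.toHomeoG * f at h
  rwa [one_mul] at h

theorem MarkedHomeo.φ_eq {m n : ℕ} (a : MarkedHomeo (stdCircle D m) (stdCircle D n)) :
    a.φ = toHomeo D a.toHomeoG := by
  have h := a.comm (1 : HomeoG D)
  change toHomeo D a.toHomeoG = (toHomeo D 1).trans a.φ at h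
  rw [h, map_one]
  rfl

theorem MarkedHomeo.mapsMarking {m n : ℕ} (a : MarkedHomeo (stdCircle D m) (stdCircle D n)) :
    MapsMarking m n a.toHomeoG := by
  have h := a.maps
  rw [a.φ_eq] at h
  exact h

theorem MarkedHomeo.homeo_mapsMarking {m n : ℕ}
    (a : MarkedHomeo (stdCircle D m) (stdCircle D n)) : a.mapsMarking.homeo = a :=
  MarkedHomeo.ext a.φ_eq.symm (Homeomorph.ext fun f => (a.φt_apply f).symm)

theorem MapsMarking.toHomeoG_homeo {m n : ℕ} {h : HomeoG D} (hh : MapsMarking m n h) :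
    hh.homeo.toHomeoG = h := mul_one (h : HomeoG D)

theorem MarkedHomeo.toHomeoG_comp {m n p : ℕ}
    (a : MarkedHomeo (stdCircle D m) (stdCircle D n))
    (b : MarkedHomeo (stdCircle D n) (stdCircle D p)) :
    (a.comp b).toHomeoG = b.toHomeoG * a.toHomeoG := b.φt_apply a.toHomeoG

/-- The morphism of the planar crossed simplicial group given by a morphism of standard marked
circles. -/
def stdHomToObjHom {m n : ℕ} (f : stdCircle D m ⟶ stdCircle D n) :
    (⟨m⟩ : Obj D) ⟶ (⟨n⟩ : Obj D) :=
  Quotient.lift (fun a : MarkedHomeo (stdCircle D m) (stdCircle D n) =>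
    floorClass m n a.toHomeoG) (by
      rintro a b ⟨γ⟩
      have h := floorClass_eq_of_path (m := m) (n := n) (fun t => (γ t).toHomeoG)
        ((MarkedHomeo.continuous_eval _).comp γ.continuous) (fun t => (γ t).mapsMarking)
      simpa using h) f

theorem stdHomToObjHom_id (n : ℕ) : stdHomToObjHom (𝟙 (stdCircle D n)) = 𝟙 (⟨n⟩ : Obj D) :=
  congrArg (Quotient.mk _) (floorMap_one n)

theorem stdHomToObjHom_comp {m n p : ℕ} (f : stdCircle D m ⟶ stdCircle D n)
    (g : stdCircle D n ⟶ stdCircle D p) :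
    stdHomToObjHom (f ≫ g) = stdHomToObjHom f ≫ stdHomToObjHom g := by
  induction f using Quotient.inductionOn with
  | _ f =>
    induction g using Quotient.inductionOn with
    | _ g =>
      change floorClass m p (f.comp g).toHomeoG = _
      rw [MarkedHomeo.toHomeoG_comp]
      obtain ⟨a, ha⟩ := QuotientGroup.mk_surjective f.toHomeoG
      obtain ⟨b, hb⟩ := QuotientGroup.mk_surjective g.toHomeoG
      have hfa : stdHomToObjHom (Quotient.mk _ f : stdCircle D m ⟶ stdCircle D n)
          = Quotient.mk _ (floorMap m n a) := congrArg (floorClass m n) ha.symm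
      have hgb : stdHomToObjHom (Quotient.mk _ g : stdCircle D n ⟶ stdCircle D p)
          = Quotient.mk _ (floorMap n p b) := congrArg (floorClass n p) hb.symm
      rw [hfa, hgb, ← ha, ← hb]
      exact congrArg (Quotient.mk _) (floorMap_mul (ha ▸ f.mapsMarking) (hb ▸ g.mapsMarking))

/-- Injectivity turns a path in the group that respects the markings into a path of marked
homeomorphisms; surjectivity is the realization of periodic maps. -/
theorem stdHomToObjHom_bijective (m n : ℕ) :
    Function.Bijective (stdHomToObjHom (D := D) (m := m) (n := n)) := by
  constructor
  · intro f g hfg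
    induction f using Quotient.inductionOn with
    | _ f =>
      induction g using Quotient.inductionOn with
      | _ g =>
        obtain ⟨u, hu, h0, h1, hm⟩ := exists_path_of_floorClass_eq f.mapsMarking g.mapsMarking hfg
        refine Quotient.sound ⟨⟨⟨fun t => (hm t).homeo, ?_⟩, ?_, ?_⟩⟩
        · exact MarkedHomeo.continuous_iff.2 fun k =>
            hu.mul (continuous_const (y := (k : HomeoG D)))
        · rw [← f.homeo_mapsMarking]
          simp only [h0]
        · rw [← g.homeo_mapsMarking]
          simp only [h1]
  · intro F
    obtain ⟨F, rfl⟩ := Quotient.exists_rep F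
    obtain ⟨a, ha, rfl⟩ := exists_lift_floorMap_eq F
    exact ⟨ZerothHomotopy.mk ha.homeo, congrArg (floorClass m n) ha.toHomeoG_homeo⟩

/-- The bijection between morphisms of standard marked circles and morphisms of the planar
crossed simplicial group. -/
def stdHomEquiv (m n : ℕ) :
    (stdCircle D m ⟶ stdCircle D n) ≃ ((⟨m⟩ : Obj D) ⟶ (⟨n⟩ : Obj D)) :=
  Equiv.ofBijective _ (stdHomToObjHom_bijective m n)

/-- The functor `[n] ↦` standard circle with `n + 1` marked intervals. -/
def realization (D : PlanarDatum) : Obj D ⥤ MarkedCircle D where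
  obj a := stdCircle D a.n
  map {a b} f := (stdHomEquiv a.n b.n).symm f
  map_id a := (Equiv.symm_apply_eq _).2 (stdHomToObjHom_id a.n).symm
  map_comp {a b c} f g := (Equiv.symm_apply_eq _).2 (by
    refine Eq.trans ?_ (stdHomToObjHom_comp _ _).symm
    exact congrArg₂ (· ≫ ·) ((stdHomEquiv a.n b.n).apply_symm_apply f).symm
      ((stdHomEquiv b.n c.n).apply_symm_apply g).symm)

instance : (realization D).IsEquivalence where
  faithful := ⟨fun {a b} => (stdHomEquiv a.n b.n).symm.injective⟩
  full := ⟨fun {a b} => (stdHomEquiv a.n b.n).symm.surjective⟩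
  essSurj := ⟨fun X => by
    obtain ⟨n, ⟨e⟩⟩ := X.marking.exists_homeomorph
    exact ⟨⟨n⟩, stdCircle_iso X e⟩⟩

/-- Marked circles are equivalent to the planar crossed simplicial group. -/
def circlesEquivalence (D : PlanarDatum) : MarkedCircle D ≌ Obj D :=
  (realization D).asEquivalence.symm

theorem circlesEquivalence_obj (X : MarkedCircle D) {n : ℕ}
    (e : X.J ≃ₜ Fin (n + 1) × unitInterval) :
    Nonempty ((circlesEquivalence D).functor.obj X ≅ ⟨n⟩) := by
  obtain ⟨i⟩ := stdCircle_iso X e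
  exact ⟨(circlesEquivalence D).functor.mapIso i.symm ≪≫
    (circlesEquivalence D).counitIso.app ⟨n⟩⟩

/-! ### Transport of the duality to the planar crossed simplicial group -/

theorem exists_selfDuality (h : ∀ X : MarkedCircle D, IsMarking (closure X.Jᶜ)) :
    ∃ S : Obj D ≌ (Obj D)ᵒᵖ, (∀ n : ℕ, S.functor.obj ⟨n⟩ = Opposite.op ⟨n⟩) ∧
      Nonempty ((circlesEquivalence D).functor ⋙ S.functor ≅
        interstice h ⋙ (circlesEquivalence D).functor.op) := by
  have := interstice_isEquivalence h
  let E := circlesEquivalence D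
  let S : Obj D ⥤ (Obj D)ᵒᵖ := E.inverse ⋙ interstice h ⋙ E.functor.op
  have hobj : ∀ a : Obj D, Nonempty (S.obj a ≅ Opposite.op a) := fun a => by
    obtain ⟨e⟩ := closure_compl_homeomorph (stdCircle D a.n) (stdMarking_homeomorph a.n).some
    exact ⟨(circlesEquivalence_obj ((stdCircle D a.n).dual (h _)) e).some.symm.op⟩
  -- The transported functor fixes objects only up to isomorphism. Conjugating by chosen
  -- isomorphisms gives a naturally isomorphic functor with the strict equality.
  let e : ∀ a, S.obj a ≅ Opposite.op a := fun a => (hobj a).some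
  have hS : (S.copyObj Opposite.op e).IsEquivalence :=
    Functor.isEquivalence_of_iso (S.isoCopyObj Opposite.op e)
  refine ⟨(S.copyObj Opposite.op e).asEquivalence, fun n => rfl, ⟨?_⟩⟩
  -- After the return to `S`, the composite `E.functor ⋙ E.inverse` at its front is cancelled by the
  -- unit.
  exact Functor.isoWhiskerLeft E.functor (S.isoCopyObj Opposite.op e).symm ≪≫
    (Functor.associator _ _ _).symm ≪≫
    Functor.isoWhiskerRight E.unitIso.symm (interstice h ⋙ E.functor.op) ≪≫
    Functor.leftUnitor _

end

end PlanarDuality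

open PlanarDuality
theorem mainTheorem7 (T : PlanarType) :
    ∃ (hdual : ∀ X : Circles T, IsMarking (closure X.Jᶜ))
      (E : Circles T ≌ PlanarCSG T) (D : PlanarCSG T ≌ (PlanarCSG T)ᵒᵖ),
      (interstice hdual).IsEquivalence ∧
      (∀ (X : Circles T) (n : ℕ), Nonempty (X.J ≃ₜ Fin (n + 1) × unitInterval) →
        Nonempty (E.functor.obj X ≅ ob T n)) ∧
      (∀ n : ℕ, D.functor.obj (ob T n) = Opposite.op (ob T n)) ∧
      Nonempty (E.functor ⋙ D.functor ≅ interstice hdual ⋙ E.functor.op) := by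
  obtain ⟨S, hS, hiso⟩ := exists_selfDuality (D := T.datum) isMarking_closure_compl
  exact ⟨isMarking_closure_compl, circlesEquivalence T.datum, S, interstice_isEquivalence _,
    fun X n ⟨e⟩ => circlesEquivalence_obj X e, hS, hiso⟩
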